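/- Let $H_4$ be the Nappi–Witten Lie algebra: the complex Lie algebra with basis $a,b,c,d$ and brackets $[a,b]=c$, $[d,a]=a$, $[d,b]=-b$, $[c,a]=[c,b]=[c,d]=0$, with the symmetric invariant bilinear form given by $(a,b)=(c,d)=1$ and all other pairings of basis vectors (up to symmetry) equal to $0$. Let $\widehat H_4=H_4\otimes\mathbb C[t,t^{-1}]\oplus\mathbb C\mathbf k$ with $\mathbf k$ central and, writing $x(m)=x\otimes t^m$, $[x(m),y(n)]=[x,y](m+n)+m(x,y)\delta_{m+n,0}\mathbf k$. Let $\tau$ be the automorphism of $H_4$ with $\tau a=b$, $\tau b=a$, $\tau c=-c$, $\tau d=-d$, let $\hat\tau(h(m)+s\mathbf k)=(-1)^m(\tau h)(m)+s\mathbf k$, and let $\widehat H_4[\tau]=\{u\in\widehat H_4 : \hat\tau(u)=u\}$ be the twisted affine Nappi–Witten Lie algebra. Let $\widehat H_4[\tau]^{(+)}$ be the subalgebra of $\widehat H_4[\tau]$ spanned by $(a+b)(n)$ for even $n>0$ and $(a-b)(m)$, $c(m)$, $d(m)$ for odd $m>0$. For a Lie algebra homomorphism $\psi:\widehat H_4[\tau]^{(+)}\to\mathbb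 C$, a vector $v$ of an $\widehat H_4[\tau]$-module is called a Whittaker vector of type $\psi$ if $v\neq0$ and $xv=\psi(x)v$ for all $x\in\widehat H_4[\tau]^{(+)}$; it is called a Whittaker vector if it is a Whittaker vector of some type. Let $M_\psi=U(\widehat H_4[\tau])\otimes_{U(\widehat H_4[\tau]^{(+)})}\mathbb C_\psi$ be the universal Whittaker module of type $\psi$, where $\mathbb C_\psi$ is $\mathbb C$ with $\widehat H_4[\tau]^{(+)}$ acting through $\psi$, and let $\omega=1\otimes1$. Let $\mathbb C[\mathbf k]\subset U(\widehat H_4[\tau])$ be the subalgebra generated by $\mathbf k$. **Corollary 3.8.** Suppose that $\psi$ is nonsingular, that is, $\psi(c(1))\neq0$. Then for every $v\in M_\psi$ the following are equivalent: (i) $v$ is a Whittaker vector of type $\psi$; (ii) $v$ is a Whittaker vector (of some type); (iii) $v\neq0$ and $v=u\omega$ for some $u\in\mathbb C[\mathbf k]$. -/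

import Mathlib

open scoped TensorProduct

noncomputable section

namespace NappiWitten

/-! ### The Nappi-Witten Lie algebra -/

/-- The vector space underlying the Nappi-Witten Lie algebra `H₄`, with coordinates
`0, 1, 2, 3` with respect to the basis `a, b, c, d`. -/
def H4 : Type := Fin 4 → ℂ

namespace H4

instance : AddCommGroup H4 := inferInstanceAs (AddCommGroup (Fin 4 → ℂ))
instance : Module ℂ H4 := inferInstanceAs (Module ℂ (Fin 4 → ℂ))

/-- The element `x₀ a + x₁ b + x₂ c + x₃ d`. -/
def mk (x₀ x₁ x₂ x₃ : ℂ) : H4 := ![x₀, x₁, x₂, x₃]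

/-- The coordinates of an element of `H₄`. -/
def coord (x : H4) (i : Fin 4) : ℂ := x i

@[simp] lemma coord_mk_zero (p q r s : ℂ) : (mk p q r s).coord 0 = p := rfl
@[simp] lemma coord_mk_one (p q r s : ℂ) : (mk p q r s).coord 1 = q := rfl
@[simp] lemma coord_mk_two (p q r s : ℂ) : (mk p q r s).coord 2 = r := rfl
@[simp] lemma coord_mk_three (p q r s : ℂ) : (mk p q r s).coord 3 = s := rfl
@[simp] lemma coord_zero (i : Fin 4) : (0 : H4).coord i = 0 := rfl
@[simp] lemma coord_add (x y : H4) (i : Fin 4) : (x + y).coord i = x.coord i + y.coord i := rfl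
@[simp] lemma coord_neg (x : H4) (i : Fin 4) : (-x).coord i = -x.coord i := rfl
@[simp] lemma coord_sub (x y : H4) (i : Fin 4) : (x - y).coord i = x.coord i - y.coord i := rfl
@[simp] lemma coord_smul (t : ℂ) (x : H4) (i : Fin 4) : (t • x).coord i = t * x.coord i := rfl

@[ext] lemma ext {x y : H4} (h₀ : x.coord 0 = y.coord 0) (h₁ : x.coord 1 = y.coord 1)
    (h₂ : x.coord 2 = y.coord 2) (h₃ : x.coord 3 = y.coord 3) : x = y := by
  funext i
  fin_cases i
  · exact h₀
  · exact h₁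
  · exact h₂
  · exact h₃

/-- The basis vector `a`. -/
def a : H4 := mk 1 0 0 0
/-- The basis vector `b`. -/
def b : H4 := mk 0 1 0 0
/-- The basis vector `c`. -/
def c : H4 := mk 0 0 1 0
/-- The basis vector `d`. -/
def d : H4 := mk 0 0 0 1

/-- The bilinear extension of `[a,b] = c`, `[d,a] = a`, `[d,b] = -b`, `c` central. -/
instance : Bracket H4 H4 where
  bracket x y := mk
    (x.coord 3 * y.coord 0 - x.coord 0 * y.coord 3)
    (x.coord 1 * y.coord 3 - x.coord 3 * y.coord 1)
    (x.coord 0 * y.coord 1 - x.coord 1 * y.coord 0)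
    0

lemma lie_def (x y : H4) : ⁅x, y⁆ = mk
    (x.coord 3 * y.coord 0 - x.coord 0 * y.coord 3)
    (x.coord 1 * y.coord 3 - x.coord 3 * y.coord 1)
    (x.coord 0 * y.coord 1 - x.coord 1 * y.coord 0)
    0 := rfl

instance : LieRing H4 where
  add_lie x y z := by ext <;> simp [lie_def] <;> ring
  lie_add x y z := by ext <;> simp [lie_def] <;> ring
  lie_self x := by ext <;> simp [lie_def] <;> ring
  leibniz_lie x y z := by ext <;> simp [lie_def] <;> ring

instance : LieAlgebra ℂ H4 where
  lie_smul t x y := by ext <;> simp [lie_def] <;> ring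

/-- The symmetric bilinear form on `H₄` with `(a,b) = (c,d) = 1` and all other pairings of basis
vectors (up to symmetry) zero. -/
def form : LinearMap.BilinForm ℂ H4 :=
  LinearMap.mk₂ ℂ
    (fun x y => x.coord 0 * y.coord 1 + x.coord 1 * y.coord 0
      + x.coord 2 * y.coord 3 + x.coord 3 * y.coord 2)
    (by intros; simp; ring) (by intros; simp; ring)
    (by intros; simp; ring) (by intros; simp; ring)

lemma form_apply (x y : H4) : form x y = x.coord 0 * y.coord 1 + x.coord 1 * y.coord 0
      + x.coord 2 * y.coord 3 + x.coord 3 * y.coord 2 := rfl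

lemma form_isSymm : form.IsSymm := ⟨fun x y => by simp [form_apply]; ring⟩

lemma form_lieInvariant : form.lieInvariant H4 := fun x y z => by
  simp [form_apply, lie_def]; ring

/-- The involution `τ` of `H₄`: `τ a = b`, `τ b = a`, `τ c = -c`, `τ d = -d`. -/
def tau : H4 →ₗ⁅ℂ⁆ H4 where
  toFun x := mk (x.coord 1) (x.coord 0) (-x.coord 2) (-x.coord 3)
  map_add' x y := by ext <;> simp <;> ring
  map_smul' t x := by ext <;> simp
  map_lie' := by intro x y; ext <;> simp [lie_def] <;> ring

lemma tau_apply (x : H4) : tau x = mk (x.coord 1) (x.coord 0) (-x.coord 2) (-x.coord 3) := rfl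

lemma form_tau (x y : H4) : form (tau x) (tau y) = form x y := by
  simp [form_apply, tau_apply]; ring

end H4

/-! ### The (non-twisted) affine Nappi-Witten Lie algebra -/

/-- The loop algebra `H₄ ⊗ ℂ[t, t⁻¹]`. -/
abbrev Loop : Type := LieAlgebra.loopAlgebra ℂ ℤ H4

/-- The cocycle `(x ⊗ tᵐ, y ⊗ tⁿ) ↦ m (x, y) δ_{m+n,0}`. The sign is there because Mathlib's cocycle
takes the value `n (x, y) δ_{m+n,0}` on this pair. -/
def cocycle : LieModule.Cohomology.twoCocycle ℂ Loop (TrivialLieModule ℂ Loop ℂ) :=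
  (-1 : ℂ) • LieAlgebra.LoopAlgebra.twoCocycleOfBilinear ℂ ℤ H4 H4.form H4.form_lieInvariant H4.form_isSymm

/-- The affine Nappi-Witten Lie algebra `Ĥ₄ = H₄ ⊗ ℂ[t, t⁻¹] ⊕ ℂ k`. -/
abbrev Affine : Type := LieAlgebra.ofTwoCocycle cocycle

namespace Affine

/-- The element `f + s k` of `Ĥ₄`, for `f` in the loop algebra and `s` a scalar. -/
def mk (f : Loop) (s : ℂ) : Affine := ⟨(f, (TrivialLieModule.equiv ℂ Loop ℂ).symm s)⟩

/-- The loop algebra component of an element of `Ĥ₄`. -/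
def loop (u : Affine) : Loop := u.carrier.1

/-- The coefficient of `k` of an element of `Ĥ₄`. -/
def central (u : Affine) : ℂ := TrivialLieModule.equiv ℂ Loop ℂ u.carrier.2

@[simp] lemma loop_mk (f : Loop) (s : ℂ) : (mk f s).loop = f := rfl
@[simp] lemma central_mk (f : Loop) (s : ℂ) : (mk f s).central = s := rfl
@[simp] lemma loop_add (u v : Affine) : (u + v).loop = u.loop + v.loop := rfl
@[simp] lemma central_add (u v : Affine) : (u + v).central = u.central + v.central := rfl
@[simp] lemma loop_smul (r : ℂ) (u : Affine) : (r • u).loop = r • u.loop := rfl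
@[simp] lemma central_smul (r : ℂ) (u : Affine) : (r • u).central = r * u.central := rfl
@[simp] lemma loop_zero : (0 : Affine).loop = 0 := rfl
@[simp] lemma central_zero : (0 : Affine).central = 0 := rfl

@[ext] lemma ext {u v : Affine} (h₁ : u.loop = v.loop) (h₂ : u.central = v.central) : u = v := by
  obtain ⟨⟨f, s⟩⟩ := u
  obtain ⟨⟨g, t⟩⟩ := v
  have h₁ : f = g := h₁
  have h₂ : s = t := h₂
  rw [h₁, h₂]

lemma lie_eq (u v : Affine) : ⁅u, v⁆ = mk ⁅u.loop, v.loop⁆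
    (-LieAlgebra.LoopAlgebra.residuePairing ℂ ℤ H4 H4.form u.loop v.loop) := by
  ext
  · rfl
  · change TrivialLieModule.equiv ℂ Loop ℂ
      ((-1 : ℂ) • (TrivialLieModule.equiv ℂ Loop ℂ).symm
          (LieAlgebra.LoopAlgebra.residuePairing ℂ ℤ H4 H4.form u.loop v.loop)
        + ⁅u.loop, v.carrier.2⁆ - ⁅v.loop, u.carrier.2⁆) = _
    rw [LieModule.IsTrivial.trivial, LieModule.IsTrivial.trivial, add_zero, sub_zero,
      map_smul, LinearEquiv.apply_symm_apply, central_mk, smul_eq_mul, neg_one_mul]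

/-- The element `x(m) = x ⊗ tᵐ` of `Ĥ₄`. -/
def of (x : H4) (m : ℤ) : Affine := mk (AddMonoidAlgebra.single m 1 ⊗ₜ[ℂ] x) 0

/-- The central element `k` of `Ĥ₄`. -/
def k : Affine := mk 0 1

/-- The defining bracket relation `[x(m), y(n)] = [x,y](m+n) + m (x,y) δ_{m+n,0} k`. -/
lemma of_lie_of (x y : H4) (m n : ℤ) :
    ⁅of x m, of y n⁆ = of ⁅x, y⁆ (m + n) + (if m + n = 0 then (m : ℂ) * H4.form x y else 0) • k := by
  rw [lie_eq]
  ext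
  · rw [loop_mk, loop_add, loop_smul]
    simp only [of, k, loop_mk]
    rw [smul_zero, add_zero, LieAlgebra.ExtendScalars.bracket_tmul,
      AddMonoidAlgebra.single_mul_single, one_mul]
  · rw [central_mk, central_add, central_smul]
    simp only [of, k, loop_mk, central_mk]
    rw [LieAlgebra.LoopAlgebra.residuePairing_apply_apply,
      LieAlgebra.LoopAlgebra.toFinsupp_single_tmul, LieAlgebra.LoopAlgebra.toFinsupp_single_tmul,
      Finsupp.sum_single_index (by simp)]
    rcases eq_or_ne (m + n) 0 with h | h
    · have h' : -n = m := by omega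
      subst h'
      simp
    · rw [Finsupp.single_eq_of_ne (by omega)]
      simp [h]

lemma k_lie (u : Affine) : ⁅k, u⁆ = 0 := by
  rw [lie_eq, k, loop_mk, map_zero]
  ext
  · exact zero_lie u.loop
  · exact neg_zero

lemma lie_k (u : Affine) : ⁅u, k⁆ = 0 := by
  rw [lie_eq, k, loop_mk, map_zero]
  ext
  · exact lie_zero u.loop
  · exact neg_zero

/-- The linear map `f(t) ↦ f(-t)` on Laurent polynomials, that is, `tᵐ ↦ (-1)ᵐ tᵐ`. -/
def negVar : AddMonoidAlgebra ℂ ℤ →ₗ[ℂ] AddMonoidAlgebra ℂ ℤ :=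
  (AddMonoidAlgebra.basis ℤ ℂ).constr ℂ fun m => AddMonoidAlgebra.single m ((-1 : ℂ) ^ m)

lemma negVar_single (m : ℤ) :
    negVar (AddMonoidAlgebra.single m 1) = (-1 : ℂ) ^ m • AddMonoidAlgebra.single m (1 : ℂ) := by
  have h := (AddMonoidAlgebra.basis ℤ ℂ).constr_basis ℂ
    (fun m : ℤ => AddMonoidAlgebra.single m ((-1 : ℂ) ^ m)) m
  rw [AddMonoidAlgebra.basis_apply] at h
  rw [negVar, h, AddMonoidAlgebra.smul_single, smul_eq_mul, mul_one]

/-- The linear map `h ⊗ tᵐ ↦ (-1)ᵐ τ(h) ⊗ tᵐ` on the loop algebra. -/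
def tauLoop : Loop →ₗ[ℂ] Loop := TensorProduct.map negVar (H4.tau : H4 →ₗ[ℂ] H4)

lemma tauLoop_tmul (m : ℤ) (h : H4) :
    tauLoop (AddMonoidAlgebra.single m 1 ⊗ₜ[ℂ] h) =
      (-1 : ℂ) ^ m • (AddMonoidAlgebra.single m 1 ⊗ₜ[ℂ] H4.tau h) := by
  rw [tauLoop, TensorProduct.map_tmul, negVar_single, TensorProduct.smul_tmul']
  rfl

/-- The loop algebra is spanned by the elements `x ⊗ tᵐ`. -/
lemma loop_induction {P : Loop → Prop} (h₀ : P 0)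
    (h₁ : ∀ (x : H4) (m : ℤ), P (AddMonoidAlgebra.single m 1 ⊗ₜ[ℂ] x))
    (h₂ : ∀ f g, P f → P g → P (f + g)) (f : Loop) : P f := by
  obtain ⟨F, rfl⟩ := (LieAlgebra.LoopAlgebra.toFinsupp ℂ ℤ H4).symm.surjective f
  induction F using Finsupp.induction_linear with
  | zero => rw [map_zero]; exact h₀
  | add F G hF hG => rw [map_add]; exact h₂ _ _ hF hG
  | single m x => rw [LieAlgebra.LoopAlgebra.toFinsupp_symm_single]; exact h₁ x m

lemma neg_one_zpow_mul (m n : ℤ) : (-1 : ℂ) ^ m * (-1 : ℂ) ^ n = (-1 : ℂ) ^ (m + n) :=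
  (zpow_add₀ (by norm_num) m n).symm

lemma loop_single_lie (x y : H4) (m n : ℤ) :
    (⁅(AddMonoidAlgebra.single m 1 ⊗ₜ[ℂ] x : Loop), (AddMonoidAlgebra.single n 1 ⊗ₜ[ℂ] y : Loop)⁆ :
      Loop) = AddMonoidAlgebra.single (m + n) 1 ⊗ₜ[ℂ] ⁅x, y⁆ := by
  rw [LieAlgebra.ExtendScalars.bracket_tmul, AddMonoidAlgebra.single_mul_single, one_mul]

lemma tauLoop_lie (f g : Loop) : tauLoop ⁅f, g⁆ = ⁅tauLoop f, tauLoop g⁆ := by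
  have zl (g : Loop) : ⁅(0 : Loop), g⁆ = 0 := zero_lie g
  have lz (g : Loop) : ⁅g, (0 : Loop)⁆ = 0 := lie_zero g
  have al (f₁ f₂ g : Loop) : ⁅f₁ + f₂, g⁆ = ⁅f₁, g⁆ + ⁅f₂, g⁆ := add_lie f₁ f₂ g
  have la (f g₁ g₂ : Loop) : ⁅f, g₁ + g₂⁆ = ⁅f, g₁⁆ + ⁅f, g₂⁆ := lie_add f g₁ g₂
  have sl (r : ℂ) (f g : Loop) : ⁅r • f, g⁆ = r • ⁅f, g⁆ := smul_lie r f g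
  have ls (r : ℂ) (f g : Loop) : ⁅f, r • g⁆ = r • ⁅f, g⁆ := lie_smul r f g
  induction f using loop_induction with
  | h₀ => rw [zl, map_zero, zl]
  | h₂ f₁ f₂ h₁ h₂ => rw [al, map_add, h₁, h₂, map_add, al]
  | h₁ x m =>
    induction g using loop_induction with
    | h₀ => rw [lz, map_zero, lz]
    | h₂ f₁ f₂ h₁ h₂ => rw [la, map_add, h₁, h₂, map_add, la]
    | h₁ y n =>
      rw [tauLoop_tmul, tauLoop_tmul, sl, ls, smul_smul, neg_one_zpow_mul,
        loop_single_lie, loop_single_lie, tauLoop_tmul, LieHom.map_lie]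

lemma residuePairing_single (x y : H4) (m n : ℤ) :
    LieAlgebra.LoopAlgebra.residuePairing ℂ ℤ H4 H4.form
      (AddMonoidAlgebra.single m 1 ⊗ₜ[ℂ] x) (AddMonoidAlgebra.single n 1 ⊗ₜ[ℂ] y) =
    if m + n = 0 then (n : ℂ) * H4.form x y else 0 := by
  rw [LieAlgebra.LoopAlgebra.residuePairing_apply_apply,
    LieAlgebra.LoopAlgebra.toFinsupp_single_tmul, LieAlgebra.LoopAlgebra.toFinsupp_single_tmul,
    Finsupp.sum_single_index (by simp)]
  rcases eq_or_ne (m + n) 0 with h | h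
  · have h' : m = -n := by omega
    subst h'
    simp
  · rw [Finsupp.single_eq_of_ne (by omega)]
    simp [h]

lemma residuePairing_tauLoop (f g : Loop) :
    LieAlgebra.LoopAlgebra.residuePairing ℂ ℤ H4 H4.form (tauLoop f) (tauLoop g) =
      LieAlgebra.LoopAlgebra.residuePairing ℂ ℤ H4 H4.form f g := by
  induction f using loop_induction with
  | h₀ => rw [map_zero, map_zero, LinearMap.zero_apply, LinearMap.zero_apply]
  | h₂ f₁ f₂ h₁ h₂ =>
    rw [map_add, map_add, map_add, LinearMap.add_apply, LinearMap.add_apply, h₁, h₂]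
  | h₁ x m =>
    induction g using loop_induction with
    | h₀ => rw [map_zero, map_zero, map_zero]
    | h₂ f₁ f₂ h₁ h₂ => rw [map_add, map_add, map_add, h₁, h₂]
    | h₁ y n =>
      rw [tauLoop_tmul, tauLoop_tmul, map_smul, map_smul, LinearMap.smul_apply, smul_smul,
        neg_one_zpow_mul, residuePairing_single, residuePairing_single, H4.form_tau]
      rcases eq_or_ne (m + n) 0 with h | h
      · rw [add_comm n m, h, zpow_zero, one_smul]
      · rw [if_neg h, smul_zero]

/-- The automorphism `τ̂` of `Ĥ₄`: `τ̂ (h ⊗ tᵐ + s k) = (-1)ᵐ τ(h) ⊗ tᵐ + s k`. -/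
def tauHat : Affine →ₗ⁅ℂ⁆ Affine where
  toFun u := mk (tauLoop u.loop) u.central
  map_add' u v := by ext <;> simp
  map_smul' r u := by ext <;> simp
  map_lie' := by
    intro u v
    ext
    · rw [lie_eq, lie_eq, loop_mk, loop_mk, loop_mk, loop_mk, loop_mk, tauLoop_lie]
    · rw [lie_eq, lie_eq, central_mk, central_mk, central_mk, loop_mk, loop_mk,
        residuePairing_tauLoop]

lemma tauHat_of (x : H4) (m : ℤ) : tauHat (of x m) = (-1 : ℂ) ^ m • of (H4.tau x) m := by
  ext
  · exact tauLoop_tmul m x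
  · simp [tauHat, of]

lemma tauHat_k : tauHat k = k := by
  ext <;> simp [tauHat, k]

end Affine

/-! ### The twisted affine Nappi-Witten Lie algebra -/

/-- The twisted affine Nappi-Witten Lie algebra `Ĥ₄[τ]`: the fixed points of `τ̂` in `Ĥ₄`. -/
def Twisted : LieSubalgebra ℂ Affine where
  carrier := {u | Affine.tauHat u = u}
  add_mem' := by
    intro u v hu hv
    simp only [Set.mem_ofPred_eq] at *
    rw [map_add, hu, hv]
  zero_mem' := map_zero _
  smul_mem' := by
    intro r u hu
    simp only [Set.mem_ofPred_eq] at *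
    rw [map_smul, hu]
  lie_mem' := by
    intro u v hu hv
    change Affine.tauHat u = u at hu
    change Affine.tauHat v = v at hv
    change Affine.tauHat ⁅u, v⁆ = ⁅u, v⁆
    rw [LieHom.map_lie, hu, hv]

namespace Affine

lemma of_smul (t : ℂ) (x : H4) (m : ℤ) : of (t • x) m = t • of x m := by
  ext
  · exact TensorProduct.tmul_smul t _ x
  · exact (mul_zero t).symm

lemma of_zero (m : ℤ) : of 0 m = 0 := by
  ext
  · exact TensorProduct.tmul_zero _ _
  · rfl

lemma of_mem_twisted {x : H4} {m : ℤ} (h : (-1 : ℂ) ^ m • H4.tau x = x) : of x m ∈ Twisted := by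
  change tauHat (of x m) = of x m
  rw [tauHat_of, ← of_smul, h]

lemma k_mem_twisted : k ∈ Twisted := tauHat_k

end Affine

namespace Twisted

/-- The element `(a+b)(2j)` of `Ĥ₄[τ]`. -/
def aPlusB (j : ℤ) : Twisted := ⟨Affine.of (H4.a + H4.b) (2 * j), Affine.of_mem_twisted <| by
  rw [(even_two_mul j).neg_one_zpow]
  ext <;> simp [H4.tau_apply, H4.a, H4.b]⟩

/-- The element `(a-b)(2j+1)` of `Ĥ₄[τ]`. -/
def aMinusB (j : ℤ) : Twisted := ⟨Affine.of (H4.a - H4.b) (2 * j + 1), Affine.of_mem_twisted <| by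
  rw [(odd_two_mul_add_one j).neg_one_zpow]
  ext <;> simp [H4.tau_apply, H4.a, H4.b]⟩

/-- The element `c(2j+1)` of `Ĥ₄[τ]`. -/
def c (j : ℤ) : Twisted := ⟨Affine.of H4.c (2 * j + 1), Affine.of_mem_twisted <| by
  rw [(odd_two_mul_add_one j).neg_one_zpow]
  ext <;> simp [H4.tau_apply, H4.c]⟩

/-- The element `d(2j+1)` of `Ĥ₄[τ]`. -/
def d (j : ℤ) : Twisted := ⟨Affine.of H4.d (2 * j + 1), Affine.of_mem_twisted <| by
  rw [(odd_two_mul_add_one j).neg_one_zpow]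
  ext <;> simp [H4.tau_apply, H4.d]⟩

/-- The central element `k` of `Ĥ₄[τ]`. -/
def k : Twisted := ⟨Affine.k, Affine.k_mem_twisted⟩

/-- The spanning set `(a+b)(n), (a-b)(m), c(m), d(m)` (`n > 0` even, `m > 0` odd) of the positive
part of `Ĥ₄[τ]`. -/
def posGenerators : Set Twisted :=
  {u | ∃ j : ℕ, u = aPlusB (j + 1) ∨ u = aMinusB j ∨ u = c j ∨ u = d j}

lemma lie_posGenerators {u v : Twisted} (hu : u ∈ posGenerators) (hv : v ∈ posGenerators) :
    ⁅u, v⁆ ∈ Submodule.span ℂ posGenerators := by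
  have hP (i : ℤ) (hi : 0 < i) : aPlusB i ∈ Submodule.span ℂ posGenerators := by
    obtain ⟨j, rfl⟩ : ∃ j : ℕ, i = j + 1 := ⟨(i - 1).toNat, by omega⟩
    exact Submodule.subset_span ⟨j, Or.inl rfl⟩
  have hM (i : ℤ) (hi : 0 ≤ i) : aMinusB i ∈ Submodule.span ℂ posGenerators := by
    lift i to ℕ using hi
    exact Submodule.subset_span ⟨i, Or.inr (Or.inl rfl)⟩
  have hC (i : ℤ) (hi : 0 ≤ i) : c i ∈ Submodule.span ℂ posGenerators := by
    lift i to ℕ using hi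
    exact Submodule.subset_span ⟨i, Or.inr (Or.inr (Or.inl rfl))⟩
  have key {x y z : H4} {m n l : ℤ} (r : ℂ) {p q w : Twisted} (hp : p.1 = Affine.of x m)
      (hq : q.1 = Affine.of y n) (hw : w.1 = Affine.of z l) (hmn : m + n ≠ 0) (hl : m + n = l)
      (h : ⁅x, y⁆ = r • z) (hmem : w ∈ Submodule.span ℂ posGenerators) :
      ⁅p, q⁆ ∈ Submodule.span ℂ posGenerators := by
    have : ⁅p, q⁆ = r • w := by
      apply Subtype.ext
      change ⁅p.1, q.1⁆ = r • w.1
      rw [hp, hq, hw, Affine.of_lie_of, if_neg hmn, zero_smul, add_zero, h, hl, Affine.of_smul]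
    rw [this]
    exact Submodule.smul_mem _ r hmem
  have key₀ {x y : H4} {m n : ℤ} {p q : Twisted} (hp : p.1 = Affine.of x m)
      (hq : q.1 = Affine.of y n) (hmn : m + n ≠ 0) (h : ⁅x, y⁆ = 0) :
      ⁅p, q⁆ ∈ Submodule.span ℂ posGenerators := by
    have : ⁅p, q⁆ = 0 := by
      apply Subtype.ext
      change ⁅p.1, q.1⁆ = 0
      rw [hp, hq, Affine.of_lie_of, if_neg hmn, zero_smul, add_zero, h, Affine.of_zero]
    rw [this]
    exact Submodule.zero_mem _
  obtain ⟨i, rfl | rfl | rfl | rfl⟩ := hu <;> obtain ⟨j, rfl | rfl | rfl | rfl⟩ := hv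
  · exact key₀ rfl rfl (by omega) (lie_self _)
  · exact key (-2) rfl rfl rfl (by omega) (l := 2 * (i + j + 1 : ℤ) + 1) (by ring)
      (by ext <;> simp [H4.lie_def, H4.a, H4.b, H4.c]; norm_num) (hC _ (by omega))
  · exact key₀ rfl rfl (by omega) (by ext <;> simp [H4.lie_def, H4.a, H4.b, H4.c])
  · exact key (-1) rfl rfl rfl (by omega) (l := 2 * (i + j + 1 : ℤ) + 1) (by ring)
      (by ext <;> simp [H4.lie_def, H4.a, H4.b, H4.d]) (hM _ (by omega))
  · exact key 2 rfl rfl rfl (by omega) (l := 2 * (i + j + 1 : ℤ) + 1) (by ring)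
      (by ext <;> simp [H4.lie_def, H4.a, H4.b, H4.c]; norm_num) (hC _ (by omega))
  · exact key₀ rfl rfl (by omega) (lie_self _)
  · exact key₀ rfl rfl (by omega) (by ext <;> simp [H4.lie_def, H4.a, H4.b, H4.c])
  · exact key (-1) rfl rfl rfl (by omega) (l := 2 * (i + j + 1 : ℤ)) (by ring)
      (by ext <;> simp [H4.lie_def, H4.a, H4.b, H4.d]) (hP _ (by omega))
  · exact key₀ rfl rfl (by omega) (by ext <;> simp [H4.lie_def, H4.a, H4.b, H4.c])
  · exact key₀ rfl rfl (by omega) (by ext <;> simp [H4.lie_def, H4.a, H4.b, H4.c])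
  · exact key₀ rfl rfl (by omega) (lie_self _)
  · exact key₀ rfl rfl (by omega) (by ext <;> simp [H4.lie_def, H4.c, H4.d])
  · exact key 1 rfl rfl rfl (by omega) (l := 2 * (i + j + 1 : ℤ) + 1) (by ring)
      (by ext <;> simp [H4.lie_def, H4.a, H4.b, H4.d]) (hM _ (by omega))
  · exact key 1 rfl rfl rfl (by omega) (l := 2 * (i + j + 1 : ℤ)) (by ring)
      (by ext <;> simp [H4.lie_def, H4.a, H4.b, H4.d]) (hP _ (by omega))
  · exact key₀ rfl rfl (by omega) (by ext <;> simp [H4.lie_def, H4.c, H4.d])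
  · exact key₀ rfl rfl (by omega) (lie_self _)

/-- The positive part `Ĥ₄[τ]⁽⁺⁾` of `Ĥ₄[τ]`: the linear span of the elements `(a+b)(n)`, `(a-b)(m)`,
`c(m)`, `d(m)` for `n > 0` even and `m > 0` odd. -/
def pos : LieSubalgebra ℂ Twisted where
  toSubmodule := Submodule.span ℂ posGenerators
  lie_mem' := by
    intro u v hu hv
    change u ∈ Submodule.span ℂ posGenerators at hu
    change v ∈ Submodule.span ℂ posGenerators at hv
    change ⁅u, v⁆ ∈ Submodule.span ℂ posGenerators
    induction hu, hv using Submodule.span_induction₂ with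
    | mem_mem u v hu hv => exact lie_posGenerators hu hv
    | zero_left v hv => rw [zero_lie]; exact Submodule.zero_mem _
    | zero_right u hu => rw [lie_zero]; exact Submodule.zero_mem _
    | add_left u₁ u₂ v _ _ _ h₁ h₂ => rw [add_lie]; exact Submodule.add_mem _ h₁ h₂
    | add_right u v₁ v₂ _ _ _ h₁ h₂ => rw [lie_add]; exact Submodule.add_mem _ h₁ h₂
    | smul_left r u v _ _ h => rw [smul_lie]; exact Submodule.smul_mem _ r h
    | smul_right r u v _ _ h => rw [lie_smul]; exact Submodule.smul_mem _ r h

/-- The element `c(1)` of `Ĥ₄[τ]⁽⁺⁾`. -/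
def posC1 : pos := ⟨c 0, Submodule.subset_span ⟨0, Or.inr (Or.inr (Or.inl rfl))⟩⟩

end Twisted

/-! ### Whittaker vectors and the universal Whittaker module -/

section Whittaker

variable {L : Type} [LieRing L] [LieAlgebra ℂ L]

/-- Let `n` be a subalgebra of `L` and `ψ : n → ℂ` a homomorphism of Lie algebras. A vector `v` of an
`L`-module is a Whittaker vector of type `ψ` if it is nonzero and `x v = ψ(x) v` for all `x ∈ n`. -/
def IsWhittakerVector {n : LieSubalgebra ℂ L} (ψ : LieAlgebra.LieCharacter ℂ n)
    {M : Type} [AddCommGroup M] [Module ℂ M] [LieRingModule L M] (v : M) : Prop :=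
  v ≠ 0 ∧ ∀ x : n, ⁅(x : L), v⁆ = ψ x • v

attribute [local instance 100] LieRing.ofAssociativeRing

/-- The homomorphism `U(n) → U(L)` induced by the inclusion of a subalgebra `n` of `L`. -/
def envelopingIncl (n : LieSubalgebra ℂ L) :
    UniversalEnvelopingAlgebra ℂ n →ₐ[ℂ] UniversalEnvelopingAlgebra ℂ L :=
  UniversalEnvelopingAlgebra.lift ℂ ((UniversalEnvelopingAlgebra.ι ℂ).comp n.incl)

/-- The homomorphism `U(n) → ℂ` extending `ψ`, by which `U(n)` acts on the one-dimensional
module `ℂ_ψ`. -/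
def envelopingChar {n : LieSubalgebra ℂ L} (ψ : LieAlgebra.LieCharacter ℂ n) :
    UniversalEnvelopingAlgebra ℂ n →ₐ[ℂ] ℂ :=
  UniversalEnvelopingAlgebra.lift ℂ ψ

/-- The `U(L)`-submodule of `U(L) ⊗_ℂ ℂ` by which one has to divide to get the tensor product
over `U(n)` of `U(L)` and `ℂ_ψ`: it is spanned by the elements `u s ⊗ z - u ⊗ s z` for `u ∈ U(L)`,
`s ∈ U(n)` and `z ∈ ℂ_ψ`. -/
def balancing {n : LieSubalgebra ℂ L} (ψ : LieAlgebra.LieCharacter ℂ n) :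
    Submodule (UniversalEnvelopingAlgebra ℂ L) (UniversalEnvelopingAlgebra ℂ L ⊗[ℂ] ℂ) :=
  Submodule.span _ {w | ∃ (u : UniversalEnvelopingAlgebra ℂ L) (s : UniversalEnvelopingAlgebra ℂ n)
    (z : ℂ), w = (u * envelopingIncl n s) ⊗ₜ[ℂ] z - u ⊗ₜ[ℂ] (envelopingChar ψ s * z)}

/-- The universal Whittaker module `M_ψ = U(L) ⊗_{U(n)} ℂ_ψ`. -/
def UniversalWhittaker {n : LieSubalgebra ℂ L} (ψ : LieAlgebra.LieCharacter ℂ n) : Type :=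
  (UniversalEnvelopingAlgebra ℂ L ⊗[ℂ] ℂ) ⧸ balancing ψ

namespace UniversalWhittaker

variable {n : LieSubalgebra ℂ L} (ψ : LieAlgebra.LieCharacter ℂ n)

instance : AddCommGroup (UniversalWhittaker ψ) :=
  inferInstanceAs (AddCommGroup (_ ⧸ balancing ψ))

instance : Module (UniversalEnvelopingAlgebra ℂ L) (UniversalWhittaker ψ) :=
  inferInstanceAs (Module (UniversalEnvelopingAlgebra ℂ L) (_ ⧸ balancing ψ))

instance : Module ℂ (UniversalWhittaker ψ) :=
  inferInstanceAs (Module ℂ (_ ⧸ balancing ψ))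

instance : IsScalarTower ℂ (UniversalEnvelopingAlgebra ℂ L) (UniversalWhittaker ψ) :=
  inferInstanceAs (IsScalarTower ℂ (UniversalEnvelopingAlgebra ℂ L) (_ ⧸ balancing ψ))

/-- The action of `L` on `M_ψ` through `L → U(L)`. -/
instance : LieRingModule L (UniversalWhittaker ψ) where
  bracket x v := UniversalEnvelopingAlgebra.ι ℂ x • v
  add_lie x y v := by
    rw [map_add, add_smul]
  lie_add x v w := smul_add _ v w
  leibniz_lie x y v := by
    change UniversalEnvelopingAlgebra.ι ℂ x • UniversalEnvelopingAlgebra.ι ℂ y • v =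
      UniversalEnvelopingAlgebra.ι ℂ ⁅x, y⁆ • v +
        UniversalEnvelopingAlgebra.ι ℂ y • UniversalEnvelopingAlgebra.ι ℂ x • v
    rw [LieHom.map_lie, LieRing.of_associative_ring_bracket, smul_smul, smul_smul, ← add_smul,
      sub_add_cancel]

lemma bracket_eq (x : L) (v : UniversalWhittaker ψ) :
    ⁅x, v⁆ = UniversalEnvelopingAlgebra.ι ℂ x • v := rfl

instance : LieModule ℂ L (UniversalWhittaker ψ) where
  smul_lie t x v := by rw [bracket_eq, bracket_eq, map_smul, smul_assoc]
  lie_smul t x v := by rw [bracket_eq, bracket_eq, smul_algebra_smul_comm]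

/-- The cyclic vector `ω = 1 ⊗ 1` of `M_ψ`. -/
def omega : UniversalWhittaker ψ :=
  Submodule.Quotient.mk (p := balancing ψ) (1 ⊗ₜ[ℂ] 1)

end UniversalWhittaker

end Whittaker

/-- The subalgebra `ℂ[k]` of `U(Ĥ₄[τ])` generated by `k`. -/
def polyK : Subalgebra ℂ (UniversalEnvelopingAlgebra ℂ Twisted) :=
  Algebra.adjoin ℂ {UniversalEnvelopingAlgebra.ι ℂ Twisted.k}

end NappiWitten

end

/-! Write `v n` for `(a + (-1)ⁿ b)(n)`. The letters with negative labels are `d(-2j-1)`, `v(-j)`,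
`c(-2j-1)` and `k`. By Poincaré-Birkhoff-Witt, with the positive part ordered last, the ordered
monomials in these letters applied to `ω` form a basis of `M_ψ`. So `M_ψ` is, as a vector space, a
polynomial ring (`coord`, `toWhittaker`), in which `k` and the negative `c` act by multiplication.

On suitable subrings a positive element acts as a scalar plus a derivation `D` (`lie_toWhittaker`).
This `D` maps every variable to a polynomial that `D` kills, so it is locally nilpotent and has no
nonzero eigenvalue. Hence `D` kills every eigenvector, whatever the eigenvalue
(`mkDerivation_eq_zero_of_eigenvector`). This is why the type of the Whittaker vector plays no role.

Three families of operators then remove the variables other than `k`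
(`mem_supported_k_of_isWhittakerVector`). For `c(2j+1)` the derivation is `(2j+1) k ∂/∂d(-2j-1)`,
and `k` is not a zero divisor, so no `d` occurs. Without `d`, the positive `c` act by scalars:
`ψ(c(1)) ≠ 0` for `c(1)`, and `0` for the others, which are brackets in the positive part. If
`v(-m)` is the letter `v` of largest `m` that occurs, then `v(m+1)` acts up to a scalar as a nonzero
multiple of `∂/∂v(-m)`, so no `v` occurs. Finally `d(2j+1)` gives `(2j+1) k ∂/∂c(-2j-1)`, so no `c`
occurs. The converse holds because `k` is central.

The Poincaré-Birkhoff-Witt theorem is proved for Lie algebras with a left-symmetric product. The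
twisted algebra has one, being the semidirect product of the abelian span of the `d` with the 2-step
nilpotent ideal spanned by the `v`, the `c` and `k`. -/

noncomputable section

namespace NappiWitten

/-! ### Reordering products modulo shorter ones. -/

section ShortProducts

variable {ι K A : Type*} [CommRing K] [Ring A] [Algebra K A] (e : ι → A)

/-- The span of the products of fewer than `n` factors `e i`. -/
def shortProducts (K : Type*) {A : Type*} [CommRing K] [Ring A] [Algebra K A] {ι : Type*}
    (e : ι → A) (n : ℕ) : Submodule K A :=
  Submodule.span K {x | ∃ l : List ι, l.length < n ∧ x = (l.map e).prod}

lemma shortProducts_mono {m n : ℕ} (h : m ≤ n) : shortProducts K e m ≤ shortProducts K e n :=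
  Submodule.span_mono fun _ ⟨l, hl, hx⟩ => ⟨l, hl.trans_le h, hx⟩

lemma prod_mem_shortProducts {l : List ι} {n : ℕ} (h : l.length < n) :
    (l.map e).prod ∈ shortProducts K e n :=
  Submodule.subset_span ⟨l, h, rfl⟩

lemma mul_mem_shortProducts (i : ι) {n : ℕ} {x : A} (hx : x ∈ shortProducts K e n) :
    e i * x ∈ shortProducts K e (n + 1) := by
  induction hx using Submodule.span_induction with
  | mem x hx =>
    obtain ⟨l, hl, rfl⟩ := hx
    exact Submodule.subset_span ⟨i :: l, by simpa using hl, by simp⟩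
  | zero => rw [mul_zero]; exact Submodule.zero_mem _
  | add x y _ _ hx hy => rw [mul_add]; exact Submodule.add_mem _ hx hy
  | smul r x _ hx => rw [mul_smul_comm]; exact Submodule.smul_mem _ r hx

lemma span_mul_mem_shortProducts {n : ℕ} {x y : A} (hy : y ∈ Submodule.span K (Set.range e))
    (hx : x ∈ shortProducts K e n) : y * x ∈ shortProducts K e (n + 1) := by
  induction hy using Submodule.span_induction with
  | mem y hy =>
    obtain ⟨i, rfl⟩ := hy
    exact mul_mem_shortProducts e i hx
  | zero => rw [zero_mul]; exact Submodule.zero_mem _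
  | add y z _ _ hy hz => rw [add_mul]; exact Submodule.add_mem _ hy hz
  | smul r y _ hy => rw [smul_mul_assoc]; exact Submodule.smul_mem _ r hy

/-- Exchanging two neighbours costs their commutator, which is linear in the `e i`; two factors are
thus replaced by one. -/
lemma prod_sub_prod_mem_shortProducts
    (he : ∀ i j, e i * e j - e j * e i ∈ Submodule.span K (Set.range e))
    {l l' : List ι} (h : l.Perm l') :
    (l.map e).prod - (l'.map e).prod ∈ shortProducts K e l.length := by
  induction h with
  | nil => simp
  | cons a h ih =>
    rw [List.map_cons, List.map_cons, List.prod_cons, List.prod_cons, ← mul_sub]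
    exact mul_mem_shortProducts e a ih
  | swap a b l =>
    simp only [List.map_cons, List.prod_cons, ← mul_assoc, ← sub_mul]
    exact span_mul_mem_shortProducts e (he b a) (prod_mem_shortProducts e (Nat.lt_succ_self _))
  | trans h₁ _ ih₁ ih₂ =>
    rw [← sub_add_sub_cancel]
    exact Submodule.add_mem _ ih₁ (h₁.length_eq ▸ ih₂)

end ShortProducts

/-! ### Ordered monomials in a noncommutative ring. -/

section OrderedMonomial

variable {ι : Type*} [LinearOrder ι]

section Monoid

variable {A : Type*} [Monoid A]

/-- The product of the `e i`, in increasing order of `i`, with multiplicities `γ i`. -/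
def orderedMonomial (e : ι → A) (γ : ι →₀ ℕ) : A :=
  ((γ.toMultiset.sort (· ≤ ·)).map e).prod

lemma orderedMonomial_of_sorted (e : ι → A) {γ : ι →₀ ℕ} {l : List ι} (hl : l.Pairwise (· ≤ ·))
    (h : γ.toMultiset = (l : Multiset ι)) : orderedMonomial e γ = (l.map e).prod := by
  have hp : (γ.toMultiset.sort (· ≤ ·)).Perm l := by
    rw [← Multiset.coe_eq_coe, Multiset.sort_eq, h]
  rw [orderedMonomial, hp.eq_of_pairwise (fun a b _ _ => le_antisymm)
    (Multiset.pairwise_sort _ _) hl]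

lemma orderedMonomial_zero (e : ι → A) : orderedMonomial e 0 = 1 :=
  orderedMonomial_of_sorted e (l := []) (by simp) (by simp)

lemma prod_map_orderedInsert (e : ι → A) (i : ι) (l : List ι)
    (h : ∀ j ∈ l, j < i → Commute (e i) (e j)) :
    ((l.orderedInsert (· ≤ ·) i).map e).prod = e i * (l.map e).prod := by
  induction l with
  | nil => simp
  | cons a l ih =>
    rw [List.orderedInsert_cons]
    split_ifs with hia
    · simp
    · rw [List.map_cons, List.prod_cons, ih fun j hj => h j (List.mem_cons_of_mem _ hj),
        List.map_cons, List.prod_cons, ← mul_assoc, ← mul_assoc,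
        (h a List.mem_cons_self (not_le.1 hia)).eq]

/-- The new factor, put on the left, has to pass only the letters smaller than `i`, so only these
must commute with it. -/
lemma orderedMonomial_single_add (e : ι → A) (i : ι) (γ : ι →₀ ℕ)
    (h : ∀ j ∈ γ.support, j < i → Commute (e i) (e j)) :
    orderedMonomial e (Finsupp.single i 1 + γ) = e i * orderedMonomial e γ := by
  rw [orderedMonomial_of_sorted e
    (l := (γ.toMultiset.sort (· ≤ ·)).orderedInsert (· ≤ ·) i)
    ((Multiset.pairwise_sort _ _).orderedInsert _ _), prod_map_orderedInsert, orderedMonomial]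
  · intro j hj
    rw [Multiset.mem_sort, Finsupp.mem_toMultiset] at hj
    exact h j hj
  · rw [Multiset.coe_eq_coe.2 (List.perm_orderedInsert _ _ _), ← Multiset.cons_coe,
      Multiset.sort_eq, map_add, Finsupp.toMultiset_single, one_smul, Multiset.singleton_add]

lemma orderedMonomial_add (e : ι → A) (α β : ι →₀ ℕ)
    (h : ∀ i ∈ α.support, ∀ j ∈ β.support, i ≤ j) :
    orderedMonomial e (α + β) = orderedMonomial e α * orderedMonomial e β := by
  rw [orderedMonomial_of_sorted e
    (l := α.toMultiset.sort (· ≤ ·) ++ β.toMultiset.sort (· ≤ ·))]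
  · rw [List.map_append, List.prod_append]
    rfl
  · refine List.pairwise_append.2 ⟨Multiset.pairwise_sort _ _, Multiset.pairwise_sort _ _, ?_⟩
    intro i hi j hj
    rw [Multiset.mem_sort, Finsupp.mem_toMultiset] at hi hj
    exact h i hi j hj
  · rw [← Multiset.coe_add, Multiset.sort_eq, Multiset.sort_eq, map_add]

lemma map_orderedMonomial {B F : Type*} [Monoid B] [FunLike F A B] [MonoidHomClass F A B]
    (f : F) (e : ι → A) (γ : ι →₀ ℕ) :
    f (orderedMonomial e γ) = orderedMonomial (fun i => f (e i)) γ := by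
  rw [orderedMonomial, orderedMonomial, map_list_prod, List.map_map]
  rfl

lemma orderedMonomial_mapDomain {κ : Type*} [LinearOrder κ] {f : κ → ι} (hf : StrictMono f)
    (e : ι → A) (γ : κ →₀ ℕ) :
    orderedMonomial e (γ.mapDomain f) = orderedMonomial (fun i => e (f i)) γ := by
  rw [orderedMonomial_of_sorted e (l := (γ.toMultiset.sort (· ≤ ·)).map f), List.map_map,
    orderedMonomial]
  · rfl
  · exact List.Pairwise.map _ (fun a b h => hf.monotone h) (Multiset.pairwise_sort _ _)
  · rw [← Finsupp.toMultiset_map, ← Multiset.map_coe, Multiset.sort_eq]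

end Monoid

lemma orderedMonomial_eq_prod {A : Type*} [CommMonoid A] (e : ι → A) (γ : ι →₀ ℕ) :
    orderedMonomial e γ = γ.prod fun i n => e i ^ n := by
  rw [orderedMonomial, ← Multiset.prod_coe, ← Multiset.map_coe, Multiset.sort_eq,
    Finsupp.toMultiset_map, Finsupp.prod_toMultiset,
    Finsupp.prod_mapDomain_index (fun _ => pow_zero _) (fun _ _ _ => pow_add _ _ _)]

section Algebra

variable {K A : Type*} [CommRing K] [Ring A] [Algebra K A] (e : ι → A)

/-- Induction on the number of factors: a product differs from its sorted form by products with
fewer factors. -/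
lemma shortProducts_le_span_orderedMonomial
    (he : ∀ i j, e i * e j - e j * e i ∈ Submodule.span K (Set.range e)) (n : ℕ) :
    shortProducts K e n ≤ Submodule.span K (Set.range (orderedMonomial e)) := by
  induction n with
  | zero => exact Submodule.span_le.2 fun x ⟨l, hl, _⟩ => absurd hl (Nat.not_lt_zero _)
  | succ n ih =>
    refine Submodule.span_le.2 ?_
    rintro _ ⟨l, hl, rfl⟩
    have hs : ((l : Multiset ι).sort (· ≤ ·)).Perm l := by
      rw [← Multiset.coe_eq_coe, Multiset.sort_eq]
    rw [← sub_add_cancel (l.map e).prod ((((l : Multiset ι).sort (· ≤ ·)).map e).prod)]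
    refine Submodule.add_mem _ (ih (shortProducts_mono e (Nat.lt_succ_iff.1 hl)
      (prod_sub_prod_mem_shortProducts e he hs.symm))) (Submodule.subset_span
      ⟨Multiset.toFinsupp (l : Multiset ι), ?_⟩)
    rw [orderedMonomial, Multiset.toFinsupp_toMultiset]

/-- If the commutators of the `e i` are linear combinations of the `e i`, then the ordered monomials
span the subalgebra which the `e i` generate. -/
theorem adjoin_le_span_orderedMonomial
    (he : ∀ i j, e i * e j - e j * e i ∈ Submodule.span K (Set.range e)) :
    Subalgebra.toSubmodule (Algebra.adjoin K (Set.range e)) ≤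
      Submodule.span K (Set.range (orderedMonomial e)) := by
  rw [Algebra.adjoin_eq_span, Submodule.span_le]
  intro x hx
  -- The subalgebra is the linear span of the monoid generated by the `e i`, and an element of this
  -- monoid is a word in them.
  obtain ⟨l, rfl⟩ : ∃ l : List ι, x = (l.map e).prod := by
    induction hx using Submonoid.closure_induction with
    | mem x hx =>
      obtain ⟨i, rfl⟩ := hx
      exact ⟨[i], by simp⟩
    | one => exact ⟨[], by simp⟩
    | mul x y _ _ hx hy =>
      obtain ⟨l, rfl⟩ := hx
      obtain ⟨l', rfl⟩ := hy
      exact ⟨l ++ l', by simp⟩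
  exact shortProducts_le_span_orderedMonomial e he _
    (prod_mem_shortProducts e (Nat.lt_succ_self l.length))

end Algebra

end OrderedMonomial

end NappiWitten

namespace NappiWitten

/-! ### The Poincaré-Birkhoff-Witt theorem from a left-symmetric product. -/

section PreLie

open MvPolynomial

attribute [local instance 100] LieRing.ofAssociativeRing

variable {K : Type*} [CommRing K]

section Enveloping

variable {L : Type*} [LieRing L] [LieAlgebra K L]

/-- The map `ι` corestricts to `S`. By the universal property the composite `U(L) → S → U(L)` is the
identity, so `S` is everything. -/
lemma adjoin_range_ι :
    Algebra.adjoin K (Set.range (UniversalEnvelopingAlgebra.ι K : L → _)) = ⊤ := by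
  set S := Algebra.adjoin K (Set.range (UniversalEnvelopingAlgebra.ι K : L → _)) with hS
  let g : L →ₗ⁅K⁆ S :=
    { toFun := fun x => ⟨UniversalEnvelopingAlgebra.ι K x, Algebra.subset_adjoin ⟨x, rfl⟩⟩
      map_add' := fun x y => Subtype.ext (map_add _ x y)
      map_smul' := fun r x => Subtype.ext (map_smul _ r x)
      map_lie' := fun {x y} => Subtype.ext (LieHom.map_lie (UniversalEnvelopingAlgebra.ι K) x y) }
  have h : S.val.comp (UniversalEnvelopingAlgebra.lift K g) = AlgHom.id K _ := by
    apply UniversalEnvelopingAlgebra.hom_ext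
    ext x
    exact congrArg Subtype.val (UniversalEnvelopingAlgebra.lift_ι_apply K g x)
  refine eq_top_iff.2 fun u _ => ?_
  have hu : (UniversalEnvelopingAlgebra.lift K g u : UniversalEnvelopingAlgebra K L) = u :=
    DFunLike.congr_fun h u
  exact hu ▸ (UniversalEnvelopingAlgebra.lift K g u).2

/-- The ordered monomials in a spanning set of a Lie algebra span its enveloping algebra. -/
theorem span_orderedMonomial_ι {ι : Type*} [LinearOrder ι] (b : ι → L)
    (hb : ⊤ ≤ Submodule.span K (Set.range b)) :
    Submodule.span K (Set.range
      (orderedMonomial fun i => UniversalEnvelopingAlgebra.ι K (b i))) = ⊤ := by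
  have hmem (x : L) : UniversalEnvelopingAlgebra.ι K x ∈
      Submodule.span K (Set.range fun i => UniversalEnvelopingAlgebra.ι K (b i)) := by
    have : UniversalEnvelopingAlgebra.ι K x ∈ (Submodule.span K (Set.range b)).map
        (LieHom.toLinearMap (UniversalEnvelopingAlgebra.ι K)) :=
      ⟨x, hb trivial, rfl⟩
    rw [Submodule.map_span, ← Set.range_comp] at this
    exact this
  refine eq_top_iff.2 fun u _ => adjoin_le_span_orderedMonomial _ (fun i j => ?_) ?_
  · rw [← LieRing.of_associative_ring_bracket, ← LieHom.map_lie]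
    exact hmem _
  · have hu : u ∈ Algebra.adjoin K (Set.range (UniversalEnvelopingAlgebra.ι K : L → _)) := by
      rw [adjoin_range_ι]
      trivial
    refine Algebra.adjoin_le ?_ hu
    rintro _ ⟨x, rfl⟩
    exact Algebra.span_le_adjoin K _ (hmem x)

end Enveloping

section Polynomials

variable {ι : Type*}

/-- The polynomials all of whose monomials have degree less than `n`. -/
def degreeLT (K ι : Type*) [CommRing K] (n : ℕ) : Submodule K (MvPolynomial ι K) :=
  restrictSupport K {γ | γ.degree < n}

lemma mem_degreeLT {n : ℕ} {f : MvPolynomial ι K} :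
    f ∈ degreeLT K ι n ↔ ∀ γ, n ≤ γ.degree → coeff γ f = 0 := by
  rw [degreeLT, mem_restrictSupport_iff]
  constructor
  · intro h γ hγ
    by_contra h0
    exact absurd (h (mem_support_iff.2 h0)) (not_lt.2 hγ)
  · intro h γ hγ
    by_contra h0
    exact mem_support_iff.1 hγ (h γ (not_lt.1 h0))

lemma degreeLT_induction {n : ℕ} {p : MvPolynomial ι K → Prop} (h0 : p 0)
    (hadd : ∀ f g, p f → p g → p (f + g)) (hmon : ∀ γ r, γ.degree < n → p (monomial γ r))
    {f : MvPolynomial ι K} (hf : f ∈ degreeLT K ι n) : p f := by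
  rw [f.as_sum]
  refine Finset.sum_induction _ p hadd h0 fun γ hγ => hmon γ _ ?_
  exact (mem_restrictSupport_iff K).1 hf hγ

lemma monomial_mem_degreeLT {n : ℕ} {γ : ι →₀ ℕ} (h : γ.degree < n) (r : K) :
    monomial γ r ∈ degreeLT K ι n :=
  (monomial_mem_restrictSupport K).2 (Or.inl h)

lemma X_mul_mem_degreeLT {n : ℕ} (i : ι) {f : MvPolynomial ι K} (hf : f ∈ degreeLT K ι n) :
    X i * f ∈ degreeLT K ι (n + 1) := by
  refine degreeLT_induction (p := fun f => X i * f ∈ degreeLT K ι (n + 1)) ?_ ?_ ?_ hf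
  · rw [mul_zero]; exact Submodule.zero_mem _
  · intro f g hf hg
    rw [mul_add]; exact Submodule.add_mem _ hf hg
  · intro γ r hγ
    rw [X, monomial_mul, one_mul]
    apply monomial_mem_degreeLT
    rw [map_add, Finsupp.degree_single]
    omega

lemma span_X_mul_mem_degreeLT {n : ℕ} {f g : MvPolynomial ι K}
    (hg : g ∈ Submodule.span K (Set.range X)) (hf : f ∈ degreeLT K ι n) :
    g * f ∈ degreeLT K ι (n + 1) := by
  induction hg using Submodule.span_induction with
  | mem g hg =>
    obtain ⟨i, rfl⟩ := hg
    exact X_mul_mem_degreeLT i hf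
  | zero => rw [zero_mul]; exact Submodule.zero_mem _
  | add g h _ _ hg hh => rw [add_mul]; exact Submodule.add_mem _ hg hh
  | smul r g _ hg => rw [smul_mul_assoc]; exact Submodule.smul_mem _ r hg

/-- In each term of the Leibniz rule one variable is replaced by a linear form, so the degree does
not grow. -/
lemma mkDerivation_mem_degreeLT {g : ι → MvPolynomial ι K}
    (hg : ∀ i, g i ∈ Submodule.span K (Set.range X)) {n : ℕ} {f : MvPolynomial ι K}
    (hf : f ∈ degreeLT K ι n) : mkDerivation K g f ∈ degreeLT K ι n := by
  refine degreeLT_induction (p := fun f => mkDerivation K g f ∈ degreeLT K ι n) ?_ ?_ ?_ hf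
  · rw [map_zero]; exact Submodule.zero_mem _
  · intro f g hf hg
    rw [map_add]; exact Submodule.add_mem _ hf hg
  · intro γ r hγ
    rw [mkDerivation_monomial]
    refine Submodule.smul_mem _ _ (Submodule.sum_mem _ fun i hi => ?_)
    have hle : Finsupp.single i 1 ≤ γ := by
      rw [Finsupp.single_le_iff]
      exact Nat.one_le_iff_ne_zero.2 (Finsupp.mem_support_iff.1 hi)
    have hdeg : (γ - Finsupp.single i 1).degree + 1 = γ.degree := by
      conv_rhs => rw [← tsub_add_cancel_of_le hle, map_add, Finsupp.degree_single]
    obtain ⟨m, rfl⟩ : ∃ m, n = m + 1 := ⟨n - 1, by omega⟩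
    change monomial _ _ * g i ∈ _
    rw [mul_comm]
    exact span_X_mul_mem_degreeLT (hg i) (monomial_mem_degreeLT (by omega) _)

end Polynomials

variable {L ι : Type*} [LieRing L] [LieAlgebra K L] (b : Module.Basis ι K L)
  (δ : L →ₗ[K] L →ₗ[K] L)

/-- The derivation of the symmetric algebra of `L` which is `y ↦ δ x y` on `L`. -/
def preLieDerivation (x : L) : Derivation K (MvPolynomial ι K) (MvPolynomial ι K) :=
  mkDerivation K fun i => b.constr K X (δ x (b i))

lemma preLieDerivation_constr (x y : L) :
    preLieDerivation b δ x (b.constr K X y) = b.constr K X (δ x y) := by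
  have : (preLieDerivation b δ x : MvPolynomial ι K →ₗ[K] MvPolynomial ι K) ∘ₗ b.constr K X =
      b.constr K X ∘ₗ δ x := b.ext fun i => by
    simp [preLieDerivation, Module.Basis.constr_basis, mkDerivation_X]
  exact LinearMap.congr_fun this y

/-- If `δ` is a left-symmetric product on `L` whose commutator is the Lie bracket, then `L` acts on
its symmetric algebra by `x ↦ x + δ x`. -/
def preLieRep (h₁ : ∀ x y, δ x y - δ y x = ⁅x, y⁆)
    (h₂ : ∀ x y z, δ x (δ y z) - δ y (δ x z) = δ ⁅x, y⁆ z) :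
    L →ₗ⁅K⁆ Module.End K (MvPolynomial ι K) where
  toFun x := LinearMap.mulLeft K (b.constr K X x) +
    (preLieDerivation b δ x : MvPolynomial ι K →ₗ[K] MvPolynomial ι K)
  map_add' x y := by
    have : preLieDerivation b δ (x + y) = preLieDerivation b δ x + preLieDerivation b δ y :=
      derivation_ext fun i => by simp [preLieDerivation, mkDerivation_X]
    refine LinearMap.ext fun f => ?_
    simp [this, add_mul]
    abel
  map_smul' r x := by
    have : preLieDerivation b δ (r • x) = r • preLieDerivation b δ x :=
      derivation_ext fun i => by simp [preLieDerivation, mkDerivation_X]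
    refine LinearMap.ext fun f => ?_
    simp [this]
  map_lie' {x y} := by
    -- Left symmetry makes the derivations a representation. The cross terms with the
    -- multiplications then contribute `δ x y - δ y x`, which is the bracket.
    have : preLieDerivation b δ ⁅x, y⁆ = ⁅preLieDerivation b δ x, preLieDerivation b δ y⁆ :=
      derivation_ext fun i => by
        have hX (z : L) : preLieDerivation b δ z (X i) = b.constr K X (δ z (b i)) :=
          mkDerivation_X _ _ _
        rw [Derivation.commutator_apply, hX, hX, hX, preLieDerivation_constr,
          preLieDerivation_constr, ← map_sub, h₂]
    refine LinearMap.ext fun f => ?_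
    rw [LieRing.of_associative_ring_bracket, this]
    simp only [LinearMap.add_apply, LinearMap.mulLeft_apply, LinearMap.sub_apply,
      Module.End.mul_apply, Derivation.coeFn_coe, Derivation.commutator_apply, map_add,
      Derivation.leibniz, smul_eq_mul, preLieDerivation_constr, ← h₁, map_sub]
    ring

variable [LinearOrder ι]

/-- Each letter acts as multiplication by its variable plus an operator that does not raise the
degree. A word of length `n` applied to `1` therefore has the commutative monomial as its part of
degree `n`. -/
lemma orderedMonomial_ι_eq (γ : ι →₀ ℕ)
    (ρ : UniversalEnvelopingAlgebra K L →ₐ[K] Module.End K (MvPolynomial ι K))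
    (hρ : ∀ i n f, f ∈ degreeLT K ι n →
      ρ (UniversalEnvelopingAlgebra.ι K (b i)) f - X i * f ∈ degreeLT K ι n) :
    ρ (orderedMonomial (fun i => UniversalEnvelopingAlgebra.ι K (b i)) γ) 1 - monomial γ 1 ∈
      degreeLT K ι γ.degree := by
  have key (l : List ι) :
      ρ ((l.map fun i => UniversalEnvelopingAlgebra.ι K (b i)).prod) 1 - (l.map X).prod ∈
          degreeLT K ι l.length ∧
        (l.map X).prod ∈ degreeLT K ι (l.length + 1) := by
    induction l with
    | nil =>
      refine ⟨by simp, ?_⟩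
      simpa using monomial_mem_degreeLT (K := K) (γ := (0 : ι →₀ ℕ)) (n := 1) (by simp) 1
    | cons i l ih =>
      obtain ⟨h₁, h₂⟩ := ih
      refine ⟨?_, ?_⟩
      · set w := ρ ((l.map fun i => UniversalEnvelopingAlgebra.ι K (b i)).prod) 1
        have hw : w ∈ degreeLT K ι (l.length + 1) := by
          rw [← sub_add_cancel w (l.map X).prod]
          refine Submodule.add_mem _ (mem_degreeLT.2 fun γ hγ => ?_) h₂
          exact mem_degreeLT.1 h₁ γ (by omega)
        have h₃ := Submodule.add_mem _ (hρ i _ _ hw) (X_mul_mem_degreeLT i h₁)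
        rw [mul_sub, sub_add_sub_cancel] at h₃
        rw [List.map_cons, List.map_cons, List.prod_cons, List.prod_cons, map_mul]
        exact h₃
      · rw [List.map_cons, List.prod_cons]
        exact X_mul_mem_degreeLT i h₂
  have h := (key (γ.toMultiset.sort (· ≤ ·))).1
  have hX : ((γ.toMultiset.sort (· ≤ ·)).map (X : ι → MvPolynomial ι K)).prod = monomial γ 1 := by
    rw [← orderedMonomial, orderedMonomial_eq_prod, monomial_eq, C_1, one_mul]
  rw [hX, Multiset.length_sort, Finsupp.card_toMultiset] at h
  exact h

/-- The Poincaré-Birkhoff-Witt theorem for a Lie algebra which has a left-symmetric product with the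
bracket as its commutator: the ordered monomials in a basis are linearly independent. -/
theorem linearIndependent_orderedMonomial_ι (h₁ : ∀ x y, δ x y - δ y x = ⁅x, y⁆)
    (h₂ : ∀ x y z, δ x (δ y z) - δ y (δ x z) = δ ⁅x, y⁆ z) :
    LinearIndependent K (orderedMonomial fun i => UniversalEnvelopingAlgebra.ι K (b i)) := by
  let ρ := UniversalEnvelopingAlgebra.lift K (preLieRep b δ h₁ h₂)
  have hmem (x : L) : b.constr K X x ∈
      Submodule.span K (Set.range (X : ι → MvPolynomial ι K)) := by
    rw [← b.constr_range (S := K)]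
    exact LinearMap.mem_range_self _ x
  have hρ (i : ι) (n : ℕ) (f : MvPolynomial ι K) (hf : f ∈ degreeLT K ι n) :
      ρ (UniversalEnvelopingAlgebra.ι K (b i)) f - X i * f ∈ degreeLT K ι n := by
    have : ρ (UniversalEnvelopingAlgebra.ι K (b i)) f - X i * f =
        preLieDerivation b δ (b i) f := by
      rw [UniversalEnvelopingAlgebra.lift_ι_apply]
      change b.constr K X (b i) * f + _ - _ = _
      rw [b.constr_basis, add_sub_cancel_left]
      rfl
    rw [this]
    exact mkDerivation_mem_degreeLT (fun j => hmem _) hf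
  rw [linearIndependent_iff]
  intro c hc
  by_contra hne
  -- At an exponent `γ` of maximal degree in the relation, the lower-order errors of all terms have
  -- coefficient zero, so only `c γ` survives.
  obtain ⟨γ, hγ, hmax⟩ := c.support.exists_max_image (fun γ => γ.degree)
    (Finsupp.support_nonempty_iff.2 hne)
  have h := congrArg (fun u => coeff γ (ρ u 1)) hc
  simp only [Finsupp.linearCombination_apply, Finsupp.sum, map_sum, map_smul, LinearMap.sum_apply,
    LinearMap.smul_apply, coeff_sum, coeff_smul, map_zero, LinearMap.zero_apply, coeff_zero] at h
  rw [Finset.sum_eq_single γ] at h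
  · have h3 := mem_degreeLT.1 (orderedMonomial_ι_eq b γ ρ hρ) γ le_rfl
    rw [coeff_sub, coeff_monomial, if_pos rfl, sub_eq_zero] at h3
    rw [h3, smul_eq_mul, mul_one] at h
    exact Finsupp.mem_support_iff.1 hγ h
  · intro β hβ hne
    have h3 := mem_degreeLT.1 (orderedMonomial_ι_eq b β ρ hρ) γ (hmax β hβ)
    rw [coeff_sub, coeff_monomial, if_neg hne, sub_zero] at h3
    rw [h3, smul_zero]
  · intro h'
    exact absurd hγ h'

end PreLie

end NappiWitten

namespace NappiWitten

/-! ### A left-symmetric product on a semidirect product of an abelian and a 2-step nilpotent Lie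
algebra. -/

section SemidirectPreLie

variable {L : Type*} [LieRing L] [LieAlgebra ℂ L]

/-- If `P` is the projection onto a 2-step nilpotent ideal along an abelian subalgebra, then this is
a left-symmetric product with the bracket as its commutator. -/
def semidirectPreLie (P : L →ₗ[ℂ] L) : L →ₗ[ℂ] L →ₗ[ℂ] L :=
  LinearMap.mk₂ ℂ (fun x y => ⁅x - P x, P y⁆ + (1 / 2 : ℂ) • ⁅P x, P y⁆)
    (fun x y z => by simp only [map_add, add_lie, sub_lie, smul_add]; abel)
    (fun r x y => by simp only [map_smul, smul_lie, sub_lie, smul_add, smul_comm r, smul_sub])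
    (fun x y z => by simp only [map_add, lie_add, smul_add]; abel)
    (fun r x y => by simp only [map_smul, lie_smul, smul_add, smul_comm r])

lemma semidirectPreLie_apply (P : L →ₗ[ℂ] L) (x y : L) :
    semidirectPreLie P x y = ⁅x - P x, P y⁆ + (1 / 2 : ℂ) • ⁅P x, P y⁆ := rfl

variable {P : L →ₗ[ℂ] L}

lemma lie_eq_of_abelian_complement (hA : ∀ x y, ⁅x - P x, y - P y⁆ = 0) (x y : L) :
    ⁅x, y⁆ = ⁅x - P x, P y⁆ + ⁅P x, y - P y⁆ + ⁅P x, P y⁆ := by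
  have h := hA x y
  simp only [sub_lie, lie_sub] at h ⊢
  refine sub_eq_zero.1 (Eq.trans ?_ h)
  abel

/-- The factor `1/2` is forced here: `⁅P x, P y⁆` is skew, so antisymmetrizing doubles it. -/
lemma semidirectPreLie_sub (hA : ∀ x y, ⁅x - P x, y - P y⁆ = 0) (x y : L) :
    semidirectPreLie P x y - semidirectPreLie P y x = ⁅x, y⁆ := by
  rw [semidirectPreLie_apply, semidirectPreLie_apply, lie_eq_of_abelian_complement hA x y,
    ← lie_skew (P x) (y - P y), ← lie_skew (P x) (P y)]
  module

/-- By `hP` all brackets lie in the ideal, and by `hN` all triple brackets inside the ideal vanish.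
The terms with two complement parts cancel because the complement is abelian (`h₁`). The remaining
ones match by the Jacobi identity (`h₂`). -/
lemma semidirectPreLie_leftSymmetric (hA : ∀ x y, ⁅x - P x, y - P y⁆ = 0)
    (hP : ∀ x y : L, P ⁅x, y⁆ = ⁅x, y⁆) (hN : ∀ x y z : L, ⁅P x, ⁅P y, P z⁆⁆ = 0) (x y z : L) :
    semidirectPreLie P x (semidirectPreLie P y z) - semidirectPreLie P y (semidirectPreLie P x z) =
      semidirectPreLie P ⁅x, y⁆ z := by
  have h₁ : ⁅x - P x, ⁅y - P y, P z⁆⁆ - ⁅y - P y, ⁅x - P x, P z⁆⁆ = 0 := by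
    rw [← lie_lie, hA, zero_lie]
  have h₂ : ⁅⁅x, y⁆, P z⁆ = ⁅x - P x, ⁅P y, P z⁆⁆ - ⁅P y, ⁅x - P x, P z⁆⁆ +
      (⁅P x, ⁅y - P y, P z⁆⁆ - ⁅y - P y, ⁅P x, P z⁆⁆) := by
    rw [lie_eq_of_abelian_complement hA x y, add_lie, add_lie, lie_lie, lie_lie, lie_lie, hN, hN,
      sub_zero, add_zero]
  simp only [semidirectPreLie_apply, map_add, map_smul, hP, sub_self, zero_lie, zero_add,
    hN, h₂, smul_zero, add_zero]
  rw [sub_eq_zero] at h₁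
  rw [h₁]
  module

end SemidirectPreLie

/-! ### Brackets of the twisted algebra, with `a + b` and `a - b` treated uniformly. -/

namespace Twisted

/-- The element `(a + (-1)ⁿ b)(n)` of `Ĥ₄[τ]`. -/
def v (n : ℤ) : Twisted := ⟨Affine.of (H4.a + (-1 : ℂ) ^ n • H4.b) n, Affine.of_mem_twisted <| by
  have h := Affine.neg_one_zpow_mul n n
  rw [(Even.add_self n).neg_one_zpow] at h
  ext <;> simp [H4.tau_apply, H4.a, H4.b, h]⟩

lemma aPlusB_eq (j : ℤ) : aPlusB j = v (2 * j) := by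
  apply Subtype.ext
  change Affine.of _ _ = Affine.of _ _
  rw [(even_two_mul j).neg_one_zpow, one_smul]

lemma aMinusB_eq (j : ℤ) : aMinusB j = v (2 * j + 1) := by
  apply Subtype.ext
  change Affine.of _ _ = Affine.of _ _
  rw [(odd_two_mul_add_one j).neg_one_zpow, neg_one_smul, sub_eq_add_neg]

lemma k_lie (u : Twisted) : ⁅k, u⁆ = 0 := Subtype.ext (Affine.k_lie u)

lemma lie_k (u : Twisted) : ⁅u, k⁆ = 0 := Subtype.ext (Affine.lie_k u)

lemma d_lie_d (i j : ℤ) : ⁅d i, d j⁆ = 0 := by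
  apply Subtype.ext
  change ⁅Affine.of _ _, Affine.of _ _⁆ = 0
  rw [Affine.of_lie_of, lie_self, Affine.of_zero]
  simp [H4.form_apply, H4.d]

lemma c_lie_c (i j : ℤ) : ⁅c i, c j⁆ = 0 := by
  apply Subtype.ext
  change ⁅Affine.of _ _, Affine.of _ _⁆ = 0
  rw [Affine.of_lie_of, lie_self, Affine.of_zero]
  simp [H4.form_apply, H4.c]

lemma c_lie_v (i n : ℤ) : ⁅c i, v n⁆ = 0 := by
  apply Subtype.ext
  change ⁅Affine.of _ _, Affine.of _ _⁆ = 0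
  have : ⁅H4.c, H4.a + (-1 : ℂ) ^ n • H4.b⁆ = 0 := by
    ext <;> simp [H4.lie_def, H4.a, H4.b, H4.c]
  rw [Affine.of_lie_of, this, Affine.of_zero]
  simp [H4.form_apply, H4.a, H4.b, H4.c]

lemma v_lie_c (i n : ℤ) : ⁅v n, c i⁆ = 0 := by
  rw [← lie_skew (v n) (c i), c_lie_v, neg_zero]

lemma c_lie_d (i j : ℤ) :
    ⁅c i, d j⁆ = (if i + j + 1 = 0 then (2 * i + 1 : ℂ) else 0) • k := by
  apply Subtype.ext
  change ⁅Affine.of _ _, Affine.of _ _⁆ = _ • Affine.k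
  have : ⁅H4.c, H4.d⁆ = 0 := by ext <;> simp [H4.lie_def, H4.c, H4.d]
  rw [Affine.of_lie_of, this, Affine.of_zero, zero_add]
  congr 1
  by_cases h : i + j + 1 = 0
  · rw [if_pos h, if_pos (by omega)]
    simp [H4.form_apply, H4.c, H4.d]
  · rw [if_neg h, if_neg (by omega)]

lemma d_lie_c (i j : ℤ) :
    ⁅d i, c j⁆ = (if i + j + 1 = 0 then (2 * i + 1 : ℂ) else 0) • k := by
  rw [← lie_skew (d i) (c j), c_lie_d, ← neg_smul, add_comm j i]
  congr 1
  split_ifs with h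
  · have : (j : ℂ) = -i - 1 := by
      rw [show j = -i - 1 by omega]
      push_cast
      ring
    rw [this]
    ring
  · exact neg_zero

lemma d_lie_v (i n : ℤ) : ⁅d i, v n⁆ = v (2 * i + 1 + n) := by
  apply Subtype.ext
  change ⁅Affine.of _ _, Affine.of _ _⁆ = Affine.of _ _
  have : ⁅H4.d, H4.a + (-1 : ℂ) ^ n • H4.b⁆ = H4.a + (-1 : ℂ) ^ (2 * i + 1 + n) • H4.b := by
    rw [← Affine.neg_one_zpow_mul, (odd_two_mul_add_one i).neg_one_zpow]
    ext <;> simp [H4.lie_def, H4.a, H4.b, H4.d]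
  rw [Affine.of_lie_of, this]
  simp [H4.form_apply, H4.a, H4.b, H4.d]

lemma v_lie_d (i n : ℤ) : ⁅v n, d i⁆ = -v (2 * i + 1 + n) := by
  rw [← lie_skew (v n) (d i), d_lie_v]

/-- Here `m` and `n` have opposite parity, so the bracket is that of `a + εb` and `a - εb`, where `ε
= (-1)ᵐ`. There is no central term since `m + n ≠ 0`. -/
lemma v_lie_v_of_odd (m n j : ℤ) (h : m + n = 2 * j + 1) :
    ⁅v m, v n⁆ = (-2 * (-1 : ℂ) ^ m) • c j := by
  apply Subtype.ext
  change ⁅Affine.of _ _, Affine.of _ _⁆ = _ • Affine.of _ _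
  have hn : (-1 : ℂ) ^ n = -(-1) ^ m := by
    have hh := Affine.neg_one_zpow_mul m (m + n)
    rw [h, (odd_two_mul_add_one j).neg_one_zpow] at hh
    rw [show n = (-m) + (2 * j + 1) by omega, ← Affine.neg_one_zpow_mul,
      (odd_two_mul_add_one j).neg_one_zpow, mul_neg_one, zpow_neg, ← inv_zpow]
    norm_num
  have : ⁅H4.a + (-1 : ℂ) ^ m • H4.b, H4.a + (-1 : ℂ) ^ n • H4.b⁆ =
      (-2 * (-1 : ℂ) ^ m) • H4.c := by
    rw [hn]
    ext <;> simp [H4.lie_def, H4.a, H4.b, H4.c]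
    ring
  rw [Affine.of_lie_of, this, Affine.of_smul, h, if_neg (by omega), zero_smul, add_zero]

/-- With equal parities both factors come from the same vector `a + εb` of `H₄`. Only the cocycle
remains, and the form takes the value `2ε` on this vector. -/
lemma v_lie_v_of_even (m n : ℤ) (h : Even (m + n)) :
    ⁅v m, v n⁆ = (if m + n = 0 then 2 * (-1 : ℂ) ^ m * m else 0) • k := by
  apply Subtype.ext
  change ⁅Affine.of _ _, Affine.of _ _⁆ = _ • Affine.k
  have hn : (-1 : ℂ) ^ n = (-1) ^ m := by
    rw [show n = (-m) + (m + n) by omega, ← Affine.neg_one_zpow_mul, h.neg_one_zpow, mul_one,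
      zpow_neg, ← inv_zpow]
    norm_num
  rw [Affine.of_lie_of, hn, lie_self, Affine.of_zero, zero_add]
  congr 2
  simp [H4.form_apply, H4.a, H4.b]
  ring

end Twisted

end NappiWitten

/-! ### A basis of the twisted algebra. -/

namespace NappiWitten

/-- Labels for a basis of `Ĥ₄[τ]`, see `Gen.vec`. The labels `posV`, `posC`, `posD` are those of the
positive part. -/
inductive Gen
  | d (j : ℕ)
  | v (j : ℕ)
  | c (j : ℕ)
  | k
  | posV (j : ℕ)
  | posC (j : ℕ)
  | posD (j : ℕ)

namespace Gen

/-- The position of a label in the order of the basis. -/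
def key : Gen → ℕ ×ₗ ℕ
  | d j => toLex (0, j)
  | v j => toLex (1, j)
  | c j => toLex (2, j)
  | k => toLex (3, 0)
  | posV j => toLex (4, j)
  | posC j => toLex (5, j)
  | posD j => toLex (6, j)

lemma key_injective : Function.Injective key := by
  intro x y h
  cases x <;> cases y <;> simp_all [key]

instance : LinearOrder Gen := LinearOrder.lift' key key_injective

lemma lt_iff {x y : Gen} : x < y ↔ key x < key y := Iff.rfl

/-- The labels of the basis of the positive part. -/
def positive : Set Gen := {x | ∃ j, x = posV j ∨ x = posC j ∨ x = posD j}

/-- With the positive labels last, an ordered monomial is a negative monomial times an element of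
the enveloping algebra of the positive part, as the tensor product defining `M_ψ` requires. -/
lemma lt_of_notMem_positive {x y : Gen} (hx : x ∉ positive) (hy : y ∈ positive) : x < y := by
  rw [lt_iff]
  cases x <;> cases y <;> simp_all [positive, key, Prod.Lex.toLex_lt_toLex]

/-- The basis vectors of `Ĥ₄[τ]`. -/
def vec : Gen → Twisted
  | d j => Twisted.d (-j - 1)
  | v j => Twisted.v (-j)
  | c j => Twisted.c (-j - 1)
  | k => Twisted.k
  | posV j => Twisted.v (j + 1)
  | posC j => Twisted.c j
  | posD j => Twisted.d j

/-- The coefficient of `tᵐ` times the `i`-th basis vector of `H₄`. -/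
def loopCoord (m : ℤ) (i : Fin 4) : Twisted →ₗ[ℂ] ℂ where
  toFun u := ((LieAlgebra.LoopAlgebra.toFinsupp ℂ ℤ H4 u.1.loop) m).coord i
  map_add' u w := by
    change H4.coord (LieAlgebra.LoopAlgebra.toFinsupp ℂ ℤ H4 (u.1.loop + w.1.loop) m) i = _
    rw [map_add]
    rfl
  map_smul' r u := by
    change H4.coord (LieAlgebra.LoopAlgebra.toFinsupp ℂ ℤ H4 (r • u.1.loop) m) i = _
    rw [map_smul]
    rfl

lemma loopCoord_of {m n : ℤ} {i : Fin 4} {x : H4} {u : Twisted} (hu : u.1 = Affine.of x n) :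
    loopCoord m i u = if n = m then x.coord i else 0 := by
  change H4.coord (LieAlgebra.LoopAlgebra.toFinsupp ℂ ℤ H4 u.1.loop m) i = _
  rw [hu, Affine.of, Affine.loop_mk, LieAlgebra.LoopAlgebra.toFinsupp_single_tmul,
    Finsupp.single_apply]
  split_ifs <;> rfl

@[simp] lemma loopCoord_d (m j : ℤ) (i : Fin 4) :
    loopCoord m i (Twisted.d j) = if 2 * j + 1 = m then H4.d.coord i else 0 :=
  loopCoord_of rfl

@[simp] lemma loopCoord_c (m j : ℤ) (i : Fin 4) :
    loopCoord m i (Twisted.c j) = if 2 * j + 1 = m then H4.c.coord i else 0 :=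
  loopCoord_of rfl

@[simp] lemma loopCoord_v (m n : ℤ) (i : Fin 4) :
    loopCoord m i (Twisted.v n) = if n = m then (H4.a + (-1 : ℂ) ^ n • H4.b).coord i else 0 :=
  loopCoord_of rfl

@[simp] lemma loopCoord_k (m : ℤ) (i : Fin 4) : loopCoord m i Twisted.k = 0 := by
  change H4.coord (LieAlgebra.LoopAlgebra.toFinsupp ℂ ℤ H4 0 m) i = _
  rw [map_zero]
  rfl

/-- The coefficient of the central element. -/
def centralCoord : Twisted →ₗ[ℂ] ℂ where
  toFun u := u.1.central
  map_add' _ _ := rfl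
  map_smul' _ _ := rfl

@[simp] lemma centralCoord_d (j : ℤ) : centralCoord (Twisted.d j) = 0 := rfl
@[simp] lemma centralCoord_c (j : ℤ) : centralCoord (Twisted.c j) = 0 := rfl
@[simp] lemma centralCoord_v (j : ℤ) : centralCoord (Twisted.v j) = 0 := rfl
@[simp] lemma centralCoord_k : centralCoord Twisted.k = 1 := rfl

/-- The coordinates with respect to the basis `Gen.vec`. -/
def dual : Gen → Twisted →ₗ[ℂ] ℂ
  | d j => loopCoord (2 * (-j - 1) + 1) 3
  | v j => loopCoord (-j) 0
  | c j => loopCoord (2 * (-j - 1) + 1) 2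
  | k => centralCoord
  | posV j => loopCoord (j + 1) 0
  | posC j => loopCoord (2 * j + 1) 2
  | posD j => loopCoord (2 * j + 1) 3

lemma linearIndependent_vec : LinearIndependent ℂ vec := by
  refine LinearIndependent.of_pairwise_dual_eq_zero_one vec dual ?_ ?_
  · intro x y hxy
    cases x <;> cases y <;> simp [dual, vec, H4.a, H4.b, H4.c, H4.d] at hxy ⊢ <;> omega
  · intro x
    cases x <;> simp [dual, vec, H4.a, H4.b, H4.c, H4.d]

lemma v_mem_span (n : ℤ) : Twisted.v n ∈ Submodule.span ℂ (Set.range vec) := by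
  refine Submodule.subset_span ?_
  rcases le_or_gt n 0 with h | h
  · exact ⟨v (-n).toNat, congrArg Twisted.v (by omega)⟩
  · exact ⟨posV (n - 1).toNat, congrArg Twisted.v (by omega)⟩

lemma c_mem_span (n : ℤ) : Twisted.c n ∈ Submodule.span ℂ (Set.range vec) := by
  refine Submodule.subset_span ?_
  rcases lt_or_ge n 0 with h | h
  · exact ⟨c (-n - 1).toNat, congrArg Twisted.c (by omega)⟩
  · exact ⟨posC n.toNat, congrArg Twisted.c (by omega)⟩

lemma d_mem_span (n : ℤ) : Twisted.d n ∈ Submodule.span ℂ (Set.range vec) := by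
  refine Submodule.subset_span ?_
  rcases lt_or_ge n 0 with h | h
  · exact ⟨d (-n - 1).toNat, congrArg Twisted.d (by omega)⟩
  · exact ⟨posD n.toNat, congrArg Twisted.d (by omega)⟩

lemma toFinsupp_tauLoop (f : Loop) (m : ℤ) :
    LieAlgebra.LoopAlgebra.toFinsupp ℂ ℤ H4 (Affine.tauLoop f) m =
      (-1 : ℂ) ^ m • H4.tau (LieAlgebra.LoopAlgebra.toFinsupp ℂ ℤ H4 f m) := by
  induction f using Affine.loop_induction with
  | h₀ => simp
  | h₂ f g hf hg => rw [map_add, map_add, map_add, Finsupp.add_apply, Finsupp.add_apply, hf, hg,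
      map_add, smul_add]
  | h₁ x n =>
    rw [Affine.tauLoop_tmul, map_smul, LieAlgebra.LoopAlgebra.toFinsupp_single_tmul,
      LieAlgebra.LoopAlgebra.toFinsupp_single_tmul, Finsupp.smul_apply]
    rcases eq_or_ne n m with rfl | h
    · rw [Finsupp.single_eq_same, Finsupp.single_eq_same]
    · rw [Finsupp.single_eq_of_ne h.symm, Finsupp.single_eq_of_ne h.symm, map_zero, smul_zero,
        smul_zero]

/-- For even `m`, invariance forces equal coefficients at `a` and `b`, and none at `c` and `d`. For
odd `m` it forces opposite coefficients at `a` and `b`, while `c` and `d` are free. -/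
lemma of_mem_map_span {x : H4} {m : ℤ} (h : (-1 : ℂ) ^ m • H4.tau x = x) :
    Affine.of x m ∈ (Submodule.span ℂ (Set.range vec)).map
      (Twisted.toSubmodule.subtype : Twisted →ₗ[ℂ] Affine) := by
  have hc (i : Fin 4) := congrArg (fun y => H4.coord y i) h
  have h₀ := hc 0
  have h₁ := hc 1
  have h₂ := hc 2
  have h₃ := hc 3
  rcases Int.even_or_odd' m with ⟨j, rfl | rfl⟩
  · simp only [(even_two_mul j).neg_one_zpow, one_smul, H4.tau_apply, H4.coord_mk_zero,
      H4.coord_mk_one, H4.coord_mk_two, H4.coord_mk_three, neg_eq_self] at h₀ h₁ h₂ h₃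
    refine ⟨x.coord 0 • Twisted.v (2 * j), Submodule.smul_mem _ _ (v_mem_span _), ?_⟩
    change x.coord 0 • Affine.of _ _ = _
    rw [← Affine.of_smul, (even_two_mul j).neg_one_zpow]
    congr 1
    ext <;> simp [H4.a, H4.b, h₁, h₂, h₃]
  · simp only [(odd_two_mul_add_one j).neg_one_zpow, neg_smul, one_smul, H4.tau_apply,
      H4.coord_neg, H4.coord_mk_zero, H4.coord_mk_one] at h₀ h₁
    refine ⟨x.coord 0 • Twisted.v (2 * j + 1) + (x.coord 2 • Twisted.c j + x.coord 3 • Twisted.d j),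
      Submodule.add_mem _ (Submodule.smul_mem _ _ (v_mem_span _))
        (Submodule.add_mem _ (Submodule.smul_mem _ _ (c_mem_span _))
          (Submodule.smul_mem _ _ (d_mem_span _))), ?_⟩
    change x.coord 0 • Affine.of _ _ + (x.coord 2 • Affine.of _ _ + x.coord 3 • Affine.of _ _) = _
    have hadd (y z : H4) (n : ℤ) : Affine.of (y + z) n = Affine.of y n + Affine.of z n := by
      ext
      · exact TensorProduct.tmul_add _ _ _
      · exact (add_zero 0).symm
    rw [← Affine.of_smul, ← Affine.of_smul, ← Affine.of_smul, ← hadd, ← hadd,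
      (odd_two_mul_add_one j).neg_one_zpow]
    congr 1
    ext <;> simp [H4.a, H4.b, H4.c, H4.d, h₁]

lemma span_vec : ⊤ ≤ Submodule.span ℂ (Set.range vec) := by
  intro u _
  set F := LieAlgebra.LoopAlgebra.toFinsupp ℂ ℤ H4 u.1.loop with hF
  have hu : u.1 = ∑ m ∈ F.support, Affine.of (F m) m + u.1.central • Affine.k := by
    have hloop (s : Finset ℤ) : (∑ m ∈ s, Affine.of (F m) m).loop =
        ∑ m ∈ s, (LieAlgebra.LoopAlgebra.toFinsupp ℂ ℤ H4).symm (Finsupp.single m (F m)) := by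
      induction s using Finset.induction_on with
      | empty => rfl
      | insert m s hm ih =>
        rw [Finset.sum_insert hm, Finset.sum_insert hm, Affine.loop_add, ih,
          LieAlgebra.LoopAlgebra.toFinsupp_symm_single]
        rfl
    have hcen (s : Finset ℤ) : (∑ m ∈ s, Affine.of (F m) m).central = 0 := by
      induction s using Finset.induction_on with
      | empty => rfl
      | insert m s hm ih =>
        rw [Finset.sum_insert hm, Affine.central_add, ih]
        exact add_zero _
    ext
    · rw [Affine.loop_add, hloop, ← map_sum, Affine.loop_smul, Affine.k, Affine.loop_mk, smul_zero,
        add_zero, LinearEquiv.eq_symm_apply, ← hF]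
      exact F.sum_single.symm
    · rw [Affine.central_add, hcen, Affine.central_smul, Affine.k, Affine.central_mk, mul_one,
        zero_add]
  -- Since `τ̂` preserves the powers of `t`, invariance can be tested on each coefficient
  -- separately.
  have hfix (m : ℤ) : (-1 : ℂ) ^ m • H4.tau (F m) = F m := by
    have h : Affine.tauLoop u.1.loop = u.1.loop :=
      congrArg Affine.loop (show Affine.tauHat u.1 = u.1 from u.2)
    rw [hF, ← toFinsupp_tauLoop, h]
  have hmem : u.1 ∈ (Submodule.span ℂ (Set.range vec)).map
      (Twisted.toSubmodule.subtype : Twisted →ₗ[ℂ] Affine) := by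
    rw [hu]
    refine Submodule.add_mem _ (Submodule.sum_mem _ fun m _ => of_mem_map_span (hfix m))
      (Submodule.smul_mem _ _ ⟨Twisted.k, Submodule.subset_span ⟨k, rfl⟩, rfl⟩)
  obtain ⟨w, hw, hwu⟩ := hmem
  rwa [← Subtype.ext hwu]

/-- The basis of `Ĥ₄[τ]` with the vectors `Gen.vec`. -/
def basis : Module.Basis Gen ℂ Twisted := Module.Basis.mk linearIndependent_vec span_vec

lemma basis_apply (x : Gen) : basis x = vec x := Module.Basis.mk_apply _ _ x

end Gen

end NappiWitten

/-! ### The semidirect decomposition and the Poincaré-Birkhoff-Witt basis. -/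

namespace NappiWitten

namespace Gen

lemma twisted_induction {p : Twisted → Prop} (add : ∀ x y, p x → p y → p (x + y))
    (smul : ∀ (r : ℂ) x, p x → p (r • x)) (v : ∀ n, p (Twisted.v n)) (c : ∀ n, p (Twisted.c n))
    (d : ∀ n, p (Twisted.d n)) (k : p Twisted.k) (x : Twisted) : p x := by
  induction span_vec (Submodule.mem_top (x := x)) using Submodule.span_induction with
  | mem x hx =>
    obtain ⟨g, rfl⟩ := hx
    cases g
    · exact d _
    · exact v _
    · exact c _
    · exact k
    · exact v _
    · exact c _
    · exact d _
  | zero => exact zero_smul ℂ Twisted.k ▸ smul 0 _ k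
  | add x y _ _ hx hy => exact add x y hx hy
  | smul r x _ hx => exact smul r x hx

/-- The value of `Gen.proj` at a basis vector. -/
def projVec : Gen → Twisted
  | d _ => 0
  | v j => vec (v j)
  | c j => vec (c j)
  | k => vec k
  | posV j => vec (posV j)
  | posC j => vec (posC j)
  | posD _ => 0

/-- The projection of `Ĥ₄[τ]` onto the ideal spanned by the `v n`, `c n` and `k`, along the span of
the `d n`. -/
def proj : Twisted →ₗ[ℂ] Twisted := basis.constr ℂ projVec

lemma proj_vec (x : Gen) : proj (vec x) = projVec x := by
  rw [← basis_apply, proj, basis.constr_basis]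

@[simp] lemma proj_v (n : ℤ) : proj (Twisted.v n) = Twisted.v n := by
  rcases le_or_gt n 0 with h | h
  · obtain ⟨j, rfl⟩ : ∃ j : ℕ, n = -j := ⟨(-n).toNat, by omega⟩
    exact proj_vec (v j)
  · obtain ⟨j, rfl⟩ : ∃ j : ℕ, n = j + 1 := ⟨(n - 1).toNat, by omega⟩
    exact proj_vec (posV j)

@[simp] lemma proj_c (n : ℤ) : proj (Twisted.c n) = Twisted.c n := by
  rcases lt_or_ge n 0 with h | h
  · obtain ⟨j, rfl⟩ : ∃ j : ℕ, n = -j - 1 := ⟨(-n - 1).toNat, by omega⟩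
    exact proj_vec (c j)
  · obtain ⟨j, rfl⟩ : ∃ j : ℕ, n = j := ⟨n.toNat, by omega⟩
    exact proj_vec (posC j)

@[simp] lemma proj_d (n : ℤ) : proj (Twisted.d n) = 0 := by
  rcases lt_or_ge n 0 with h | h
  · obtain ⟨j, rfl⟩ : ∃ j : ℕ, n = -j - 1 := ⟨(-n - 1).toNat, by omega⟩
    exact proj_vec (d j)
  · obtain ⟨j, rfl⟩ : ∃ j : ℕ, n = j := ⟨n.toNat, by omega⟩
    exact proj_vec (posD j)

@[simp] lemma proj_k : proj Twisted.k = Twisted.k := proj_vec k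

lemma sub_proj_lie_sub_proj (x y : Twisted) : ⁅x - proj x, y - proj y⁆ = 0 := by
  induction x using twisted_induction with
  | add x x' hx hx' => rw [map_add, add_sub_add_comm, add_lie, hx, hx', add_zero]
  | smul r x hx => rw [map_smul, ← smul_sub, smul_lie, hx, smul_zero]
  | v n => simp
  | c n => simp
  | k => simp
  | d n =>
    induction y using twisted_induction with
    | add x x' hx hx' => rw [map_add, add_sub_add_comm, lie_add, hx, hx', add_zero]
    | smul r x hx => rw [map_smul, ← smul_sub, lie_smul, hx, smul_zero]
    | v n => simp
    | c n => simp
    | k => simp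
    | d m => simp [Twisted.d_lie_d]

lemma proj_lie (x y : Twisted) : proj ⁅x, y⁆ = ⁅x, y⁆ := by
  induction x using twisted_induction with
  | add x x' hx hx' => rw [add_lie, map_add, hx, hx']
  | smul r x hx => rw [smul_lie, map_smul, hx]
  | k => simp [Twisted.k_lie]
  | v n =>
    induction y using twisted_induction with
    | add x x' hx hx' => rw [lie_add, map_add, hx, hx']
    | smul r x hx => rw [lie_smul, map_smul, hx]
    | v m =>
      rcases Int.even_or_odd (n + m) with h | ⟨j, h⟩
      · rw [Twisted.v_lie_v_of_even n m h, map_smul, proj_k]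
      · simp [Twisted.v_lie_v_of_odd n m j h]
    | c m => simp [Twisted.v_lie_c]
    | k => simp [Twisted.lie_k]
    | d m => simp [Twisted.v_lie_d]
  | c n =>
    induction y using twisted_induction with
    | add x x' hx hx' => rw [lie_add, map_add, hx, hx']
    | smul r x hx => rw [lie_smul, map_smul, hx]
    | v m => simp [Twisted.c_lie_v]
    | c m => simp [Twisted.c_lie_c]
    | k => simp [Twisted.lie_k]
    | d m => rw [Twisted.c_lie_d, map_smul, proj_k]
  | d n =>
    induction y using twisted_induction with
    | add x x' hx hx' => rw [lie_add, map_add, hx, hx']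
    | smul r x hx => rw [lie_smul, map_smul, hx]
    | v m => simp [Twisted.d_lie_v]
    | c m => rw [Twisted.d_lie_c, map_smul, proj_k]
    | k => simp [Twisted.lie_k]
    | d m => simp [Twisted.d_lie_d]

lemma proj_lie_c (x : Twisted) (n : ℤ) : ⁅proj x, Twisted.c n⁆ = 0 := by
  induction x using twisted_induction with
  | add x x' hx hx' => rw [map_add, add_lie, hx, hx', add_zero]
  | smul r x hx => rw [map_smul, smul_lie, hx, smul_zero]
  | v n => simp [Twisted.v_lie_c]
  | c n => simp [Twisted.c_lie_c]
  | k => simp [Twisted.k_lie]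
  | d n => simp

/-- Brackets inside the ideal are combinations of the `c n` and `k`, which commute with the whole
ideal. -/
lemma proj_lie_proj_lie_proj (x y z : Twisted) : ⁅proj x, ⁅proj y, proj z⁆⁆ = 0 := by
  induction y using twisted_induction with
  | add x x' hx hx' => rw [map_add, add_lie, lie_add, hx, hx', add_zero]
  | smul r x hx => rw [map_smul, smul_lie, lie_smul, hx, smul_zero]
  | c n => rw [proj_c, ← lie_skew (Twisted.c n), proj_lie_c, neg_zero, lie_zero]
  | k => simp [Twisted.k_lie]
  | d n => simp
  | v n =>
    induction z using twisted_induction with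
    | add x x' hx hx' => rw [map_add, lie_add, lie_add, hx, hx', add_zero]
    | smul r x hx => rw [map_smul, lie_smul, lie_smul, hx, smul_zero]
    | v m =>
      rcases Int.even_or_odd (n + m) with h | ⟨j, h⟩
      · rw [proj_v, proj_v, Twisted.v_lie_v_of_even n m h, lie_smul, Twisted.lie_k, smul_zero]
      · simp [Twisted.v_lie_v_of_odd n m j h, proj_lie_c]
    | c m => simp [Twisted.v_lie_c]
    | k => simp [Twisted.lie_k]
    | d m => simp

/-- The image of a basis vector in the enveloping algebra. -/
def envVec (x : Gen) : UniversalEnvelopingAlgebra ℂ Twisted := UniversalEnvelopingAlgebra.ι ℂ (vec x)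

lemma linearIndependent_orderedMonomial_envVec : LinearIndependent ℂ (orderedMonomial envVec) := by
  have h := linearIndependent_orderedMonomial_ι basis (semidirectPreLie proj)
    (semidirectPreLie_sub sub_proj_lie_sub_proj)
    (semidirectPreLie_leftSymmetric sub_proj_lie_sub_proj proj_lie proj_lie_proj_lie_proj)
  simp only [basis_apply] at h
  exact h

lemma span_orderedMonomial_envVec :
    Submodule.span ℂ (Set.range (orderedMonomial envVec)) = ⊤ :=
  span_orderedMonomial_ι vec span_vec

/-- The Poincaré-Birkhoff-Witt basis of `U(Ĥ₄[τ])`. -/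
def pbwBasis : Module.Basis (Gen →₀ ℕ) ℂ (UniversalEnvelopingAlgebra ℂ Twisted) :=
  Module.Basis.mk linearIndependent_orderedMonomial_envVec span_orderedMonomial_envVec.ge

lemma pbwBasis_apply (γ : Gen →₀ ℕ) : pbwBasis γ = orderedMonomial envVec γ :=
  Module.Basis.mk_apply _ _ γ

lemma vec_mem_pos {x : Gen} (hx : x ∈ positive) : vec x ∈ Twisted.pos := by
  obtain ⟨j, rfl | rfl | rfl⟩ := hx
  · refine Submodule.subset_span ?_
    change Twisted.v (j + 1) ∈ Twisted.posGenerators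
    -- The label `posV j` stands for `v (j + 1)`, so even `j` gives the elements from `a - b`.
    rcases Nat.even_or_odd' j with ⟨i, rfl | rfl⟩
    · refine ⟨i, Or.inr (Or.inl ?_)⟩
      rw [Twisted.aMinusB_eq]
      push_cast
      rfl
    · refine ⟨i, Or.inl ?_⟩
      rw [Twisted.aPlusB_eq]
      push_cast
      ring_nf
  · exact Submodule.subset_span ⟨j, Or.inr (Or.inr (Or.inl rfl))⟩
  · exact Submodule.subset_span ⟨j, Or.inr (Or.inr (Or.inr rfl))⟩

/-- The basis vectors of the positive part. -/
def posVec (x : positive) : Twisted.pos := ⟨vec x, vec_mem_pos x.2⟩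

lemma span_posVec : ⊤ ≤ Submodule.span ℂ (Set.range posVec) := by
  have h : (Submodule.span ℂ (Set.range posVec)).map Twisted.pos.toSubmodule.subtype =
      Twisted.pos.toSubmodule := by
    refine le_antisymm (Submodule.map_subtype_le _ _) ?_
    rw [Submodule.map_span, ← Set.range_comp]
    refine Submodule.span_le.2 ?_
    rintro _ ⟨j, rfl | rfl | rfl | rfl⟩
    · refine Submodule.subset_span ⟨⟨posV (2 * j + 1), _, Or.inl rfl⟩, ?_⟩
      change Twisted.v _ = _
      rw [Twisted.aPlusB_eq]
      push_cast
      ring_nf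
    · refine Submodule.subset_span ⟨⟨posV (2 * j), _, Or.inl rfl⟩, ?_⟩
      change Twisted.v _ = _
      rw [Twisted.aMinusB_eq]
      push_cast
      rfl
    · exact Submodule.subset_span ⟨⟨posC j, _, Or.inr (Or.inl rfl)⟩, rfl⟩
    · exact Submodule.subset_span ⟨⟨posD j, _, Or.inr (Or.inr rfl)⟩, rfl⟩
  intro u _
  have hu : (u : Twisted) ∈ (Submodule.span ℂ (Set.range posVec)).map
      Twisted.pos.toSubmodule.subtype := by
    rw [h]
    exact u.2
  obtain ⟨w, hw, hwu⟩ := hu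
  rwa [← Subtype.ext hwu]

end Gen

end NappiWitten

namespace NappiWitten

/-! ### Polynomials in a given set of variables. -/

section Supported

open MvPolynomial

variable {σ : Type*}

lemma supported_induction {s : Set σ} {p : MvPolynomial σ ℂ → Prop}
    (add : ∀ f g, p f → p g → p (f + g)) (smul : ∀ (r : ℂ) f, p f → p (r • f))
    (mon : ∀ γ : σ →₀ ℕ, (∀ i ∈ γ.support, i ∈ s) → p (monomial γ 1))
    {f : MvPolynomial σ ℂ} (hf : f ∈ supported ℂ s) : p f := by
  rw [f.as_sum]
  refine Finset.sum_induction _ p add ?_ fun γ hγ => ?_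
  · exact zero_smul ℂ (monomial (0 : σ →₀ ℕ) (1 : ℂ)) ▸ smul 0 _ (mon 0 (by simp))
  · have := smul (coeff γ f) _ (mon γ fun i hi =>
      mem_supported.1 hf (mem_vars_iff_mem_support i |>.2 ⟨γ, hγ, hi⟩))
    rwa [smul_monomial, smul_eq_mul, mul_one] at this

lemma monomial_mem_supported {s : Set σ} {γ : σ →₀ ℕ} (h : ∀ i ∈ γ.support, i ∈ s) (r : ℂ) :
    monomial γ r ∈ supported ℂ s := by
  classical
  rw [mem_supported]
  intro i hi
  rcases eq_or_ne r 0 with rfl | hr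
  · simp at hi
  · rw [vars_monomial hr] at hi
    exact h i hi

lemma mkDerivation_mem_supported {t : Set σ} {g : σ → MvPolynomial σ ℂ}
    (hg : ∀ i ∈ t, g i ∈ supported ℂ t) {f : MvPolynomial σ ℂ} (hf : f ∈ supported ℂ t) :
    mkDerivation ℂ g f ∈ supported ℂ t := by
  induction hf using Algebra.adjoin_induction with
  | mem f hf =>
    obtain ⟨i, hi, rfl⟩ := hf
    rw [mkDerivation_X]
    exact hg i hi
  | algebraMap r =>
    rw [Derivation.map_algebraMap]
    exact Subalgebra.zero_mem _
  | add f f' _ _ hf hf' =>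
    rw [map_add]
    exact Subalgebra.add_mem _ hf hf'
  | mul f f' h h' hf hf' =>
    rw [Derivation.leibniz]
    exact Subalgebra.add_mem _ (Subalgebra.mul_mem _ h hf') (Subalgebra.mul_mem _ h' hf)

end Supported

open MvPolynomial UniversalWhittaker Gen

/-! ### The universal Whittaker module as a cyclic module. -/

section Cyclic

attribute [local instance 100] LieRing.ofAssociativeRing

lemma ι_lie {L : Type*} [LieRing L] [LieAlgebra ℂ L] (x y : L) :
    UniversalEnvelopingAlgebra.ι ℂ ⁅x, y⁆ = UniversalEnvelopingAlgebra.ι ℂ x *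
      UniversalEnvelopingAlgebra.ι ℂ y - UniversalEnvelopingAlgebra.ι ℂ y *
      UniversalEnvelopingAlgebra.ι ℂ x := by
  rw [LieHom.map_lie, LieRing.of_associative_ring_bracket]

variable {L : Type} [LieRing L] [LieAlgebra ℂ L] {n : LieSubalgebra ℂ L}
  (ψ : LieAlgebra.LieCharacter ℂ n)

lemma envelopingIncl_ι (x : n) : envelopingIncl n (UniversalEnvelopingAlgebra.ι ℂ x) =
    UniversalEnvelopingAlgebra.ι ℂ (x : L) := by
  rw [envelopingIncl, UniversalEnvelopingAlgebra.lift_ι_apply]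
  rfl

lemma envelopingChar_ι (x : n) : envelopingChar ψ (UniversalEnvelopingAlgebra.ι ℂ x) = ψ x := by
  rw [envelopingChar, UniversalEnvelopingAlgebra.lift_ι_apply]

lemma smul_omega (u : UniversalEnvelopingAlgebra ℂ L) :
    u • omega ψ = Submodule.Quotient.mk (p := balancing ψ) (u ⊗ₜ[ℂ] 1) := by
  change Submodule.Quotient.mk (p := balancing ψ) (u • (1 ⊗ₜ[ℂ] 1)) = _
  rw [TensorProduct.smul_tmul', smul_eq_mul, mul_one]

lemma exists_smul_omega (m : UniversalWhittaker ψ) :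
    ∃ u : UniversalEnvelopingAlgebra ℂ L, m = u • omega ψ := by
  obtain ⟨w, rfl⟩ := Submodule.Quotient.mk_surjective (balancing ψ) m
  induction w using TensorProduct.induction_on with
  | zero => exact ⟨0, (zero_smul _ _).symm⟩
  | add w w' h h' =>
    obtain ⟨u, hu⟩ := h
    obtain ⟨u', hu'⟩ := h'
    exact ⟨u + u', by rw [add_smul, ← hu, ← hu']; rfl⟩
  | tmul u z =>
    refine ⟨z • u, ?_⟩
    have h : u ⊗ₜ[ℂ] z = (z • u) ⊗ₜ[ℂ] (1 : ℂ) := by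
      rw [TensorProduct.smul_tmul, smul_eq_mul, mul_one]
    rw [smul_omega]
    exact congrArg (Submodule.Quotient.mk (p := balancing ψ)) h

lemma mul_envelopingIncl_smul_omega (u : UniversalEnvelopingAlgebra ℂ L)
    (s : UniversalEnvelopingAlgebra ℂ n) :
    (u * envelopingIncl n s) • omega ψ = envelopingChar ψ s • u • omega ψ := by
  rw [← smul_assoc, smul_omega, smul_omega]
  refine (Submodule.Quotient.eq (balancing ψ)).2 (Submodule.subset_span ⟨u, s, 1, ?_⟩)
  rw [TensorProduct.smul_tmul, smul_eq_mul]

/-- A linear map on `U(L)` which is compatible with `χ_ψ` on the right factors through `M_ψ`. -/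
def liftOmega {V : Type*} [AddCommGroup V] [Module ℂ V]
    (T : UniversalEnvelopingAlgebra ℂ L →ₗ[ℂ] V)
    (hT : ∀ u s, T (u * envelopingIncl n s) = envelopingChar ψ s • T u) :
    UniversalWhittaker ψ →ₗ[ℂ] V :=
  ((balancing ψ).restrictScalars ℂ).liftQ (T ∘ₗ (TensorProduct.rid ℂ _).toLinearMap) (by
    intro w hw
    -- The balancing submodule is a span over `U(L)` but `T` is only linear over `ℂ`, so the
    -- induction has to carry all translates `u • w`.
    suffices h : ∀ u : UniversalEnvelopingAlgebra ℂ L, T (TensorProduct.rid ℂ _ (u • w)) = 0 by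
      simpa using h 1
    replace hw : w ∈ balancing ψ := hw
    induction hw using Submodule.span_induction with
    | mem w hw =>
      obtain ⟨u', s, z, rfl⟩ := hw
      intro u
      rw [smul_sub, TensorProduct.smul_tmul', TensorProduct.smul_tmul', map_sub,
        TensorProduct.rid_tmul, TensorProduct.rid_tmul, smul_eq_mul, smul_eq_mul, ← mul_assoc,
        map_sub, map_smul, map_smul, hT, smul_smul, mul_comm z, sub_self]
    | zero => simp
    | add x y _ _ hx hy => intro u; rw [smul_add, map_add, map_add, hx, hy, add_zero]
    | smul r x _ hx => intro u; rw [smul_smul]; exact hx _) ∘ₗ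
  (Submodule.Quotient.restrictScalarsEquiv ℂ (balancing ψ)).symm.toLinearMap

lemma liftOmega_smul_omega {V : Type*} [AddCommGroup V] [Module ℂ V]
    (T : UniversalEnvelopingAlgebra ℂ L →ₗ[ℂ] V)
    (hT : ∀ u s, T (u * envelopingIncl n s) = envelopingChar ψ s • T u)
    (u : UniversalEnvelopingAlgebra ℂ L) : liftOmega ψ T hT (u • omega ψ) = T u := by
  rw [smul_omega]
  change T (TensorProduct.rid ℂ _ (u ⊗ₜ[ℂ] 1)) = _
  rw [TensorProduct.rid_tmul, one_smul]

lemma lie_omega (x : n) : ⁅(x : L), omega ψ⁆ = ψ x • omega ψ := by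
  have h := mul_envelopingIncl_smul_omega ψ 1 (UniversalEnvelopingAlgebra.ι ℂ x)
  rwa [one_mul, one_smul, envelopingIncl_ι, envelopingChar_ι] at h

end Cyclic

end NappiWitten

namespace NappiWitten

open MvPolynomial UniversalWhittaker Gen

/-! ### Polynomial coordinates on `M_ψ`. -/

section Coordinates

attribute [local instance 100] LieRing.ofAssociativeRing

variable (ψ : LieAlgebra.LieCharacter ℂ Twisted.pos)

open Classical in
/-- The substitution of `ψ(x)` for the variables `x` of the positive part. -/
def evalPos : MvPolynomial Gen ℂ →ₐ[ℂ] MvPolynomial Gen ℂ :=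
  aeval fun x => if h : x ∈ positive then C (ψ (posVec ⟨x, h⟩)) else X x

lemma evalPos_monomial_of_negative {α : Gen →₀ ℕ} (hα : ∀ x ∈ α.support, x ∉ positive) :
    evalPos ψ (monomial α 1) = monomial α 1 := by
  rw [evalPos, aeval_monomial, map_one, one_mul, monomial_eq, C_1, one_mul]
  exact Finset.prod_congr rfl fun x hx => by
    dsimp only
    rw [dif_neg (hα x hx)]

lemma evalPos_monomial_of_positive (β : positive →₀ ℕ) :
    evalPos ψ (monomial (β.mapDomain (↑)) 1) =
      C (envelopingChar ψ (orderedMonomial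
        (fun i => UniversalEnvelopingAlgebra.ι ℂ (posVec i)) β)) := by
  rw [evalPos, aeval_monomial, map_one, one_mul, map_orderedMonomial, orderedMonomial_eq_prod,
    Finsupp.prod_mapDomain_index (fun _ => pow_zero _) (fun _ _ _ => pow_add _ _ _),
    Finsupp.prod, Finsupp.prod, map_prod]
  refine Finset.prod_congr rfl fun x _ => ?_
  rw [dif_pos x.2, envelopingChar_ι, C_pow]

lemma envelopingIncl_orderedMonomial (β : positive →₀ ℕ) :
    envelopingIncl Twisted.pos (orderedMonomial
      (fun i => UniversalEnvelopingAlgebra.ι ℂ (posVec i)) β) =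
      orderedMonomial envVec (β.mapDomain (↑)) := by
  rw [map_orderedMonomial, orderedMonomial_mapDomain (Subtype.strictMono_coe _)]
  congr 1
  funext i
  exact envelopingIncl_ι _

lemma exists_negative_add_positive (γ : Gen →₀ ℕ) : ∃ (α : Gen →₀ ℕ) (β : positive →₀ ℕ),
    (∀ x ∈ α.support, x ∉ positive) ∧ γ = α + β.mapDomain (↑) := by
  classical
  refine ⟨γ.filter (· ∉ positive), γ.subtypeDomain (· ∈ positive), ?_, ?_⟩
  · intro x hx
    rw [Finsupp.support_filter, Finset.mem_filter] at hx
    exact hx.2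
  · have h : (γ.subtypeDomain (· ∈ positive)).mapDomain (↑) = γ.filter (· ∈ positive) := by
      ext x
      by_cases hx : x ∈ positive
      · rw [Finsupp.filter_apply_pos _ _ hx]
        exact Finsupp.mapDomain_apply Subtype.val_injective _ ⟨x, hx⟩
      · rw [Finsupp.filter_apply_neg _ _ hx, Finsupp.mapDomain_of_notMem_range]
        rintro ⟨y, rfl⟩
        exact hx y.2
    rw [h, add_comm, Finsupp.filter_add_filter_not]

lemma orderedMonomial_negative_add_positive {α : Gen →₀ ℕ} (hα : ∀ x ∈ α.support, x ∉ positive)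
    (β : positive →₀ ℕ) : orderedMonomial envVec (α + β.mapDomain (↑)) =
      orderedMonomial envVec α * envelopingIncl Twisted.pos (orderedMonomial
        (fun i => UniversalEnvelopingAlgebra.ι ℂ (posVec i)) β) := by
  classical
  rw [envelopingIncl_orderedMonomial, orderedMonomial_add]
  intro x hx y hy
  obtain ⟨z, _, rfl⟩ := Finset.mem_image.1 (Finsupp.mapDomain_support hy)
  exact (lt_of_notMem_positive (hα x hx) z.2).le

/-- The coordinates of an element of `U(Ĥ₄[τ])` in the Poincaré-Birkhoff-Witt basis, with `ψ`
applied to the positive part. -/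
def envCoord : UniversalEnvelopingAlgebra ℂ Twisted →ₗ[ℂ] MvPolynomial Gen ℂ :=
  (evalPos ψ).toLinearMap ∘ₗ pbwBasis.constr ℂ fun γ => monomial γ 1

lemma envCoord_orderedMonomial (γ : Gen →₀ ℕ) :
    envCoord ψ (orderedMonomial envVec γ) = evalPos ψ (monomial γ 1) := by
  rw [← pbwBasis_apply, envCoord, LinearMap.comp_apply, pbwBasis.constr_basis]
  rfl

/-- For an ordered monomial `s` the product is again an ordered monomial, so its coordinates are
known. Such monomials span the enveloping algebra of the positive part; their independence there is
not needed. -/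
lemma envCoord_negative_mul {α : Gen →₀ ℕ} (hα : ∀ x ∈ α.support, x ∉ positive)
    (s : UniversalEnvelopingAlgebra ℂ Twisted.pos) :
    envCoord ψ (orderedMonomial envVec α * envelopingIncl Twisted.pos s) =
      envelopingChar ψ s • monomial α 1 := by
  have hs : s ∈ Submodule.span ℂ (Set.range
      (orderedMonomial fun i => UniversalEnvelopingAlgebra.ι ℂ (posVec i))) := by
    rw [span_orderedMonomial_ι posVec span_posVec]
    trivial
  induction hs using Submodule.span_induction with
  | mem s hs =>
    obtain ⟨β, rfl⟩ := hs
    rw [← orderedMonomial_negative_add_positive hα, envCoord_orderedMonomial]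
    have : (monomial (α + β.mapDomain (↑)) 1 : MvPolynomial Gen ℂ) =
        monomial α 1 * monomial (β.mapDomain (↑)) 1 := by
      rw [monomial_mul, one_mul]
    rw [this, map_mul, evalPos_monomial_of_negative ψ hα, evalPos_monomial_of_positive,
      mul_comm, C_mul']
  | zero => rw [map_zero, mul_zero, map_zero, map_zero, zero_smul]
  | add s t _ _ hs ht => rw [map_add, mul_add, map_add, map_add, hs, ht, add_smul]
  | smul r s _ hs => rw [map_smul, mul_smul_comm, map_smul, map_smul, hs, smul_assoc]

/-- Each basis monomial is a negative monomial times an element of the enveloping algebra of the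
positive part. The factor `s` is absorbed into the latter, on which the character is multiplicative.
-/
lemma envCoord_mul (u : UniversalEnvelopingAlgebra ℂ Twisted)
    (s : UniversalEnvelopingAlgebra ℂ Twisted.pos) :
    envCoord ψ (u * envelopingIncl Twisted.pos s) = envelopingChar ψ s • envCoord ψ u := by
  have hu : u ∈ Submodule.span ℂ (Set.range (orderedMonomial envVec)) := by
    rw [span_orderedMonomial_envVec]
    trivial
  induction hu using Submodule.span_induction with
  | mem u hu =>
    obtain ⟨γ, rfl⟩ := hu
    obtain ⟨α, β, hα, rfl⟩ := exists_negative_add_positive γ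
    rw [orderedMonomial_negative_add_positive hα, mul_assoc, ← map_mul, envCoord_negative_mul ψ hα,
      envCoord_negative_mul ψ hα, map_mul, mul_comm, mul_smul]
  | zero => rw [zero_mul, map_zero, smul_zero]
  | add u w _ _ hu hw => rw [add_mul, map_add, map_add, smul_add, hu, hw]
  | smul r u _ hu => rw [smul_mul_assoc, map_smul, map_smul, hu, smul_comm]

/-- The coordinates of an element of `M_ψ` with respect to the ordered monomials in the negative
labels. -/
def coord : UniversalWhittaker ψ →ₗ[ℂ] MvPolynomial Gen ℂ :=
  liftOmega ψ (envCoord ψ) (envCoord_mul ψ)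

/-- The linear map which takes a monomial to the corresponding ordered monomial, applied to `ω`. -/
def toWhittaker : MvPolynomial Gen ℂ →ₗ[ℂ] UniversalWhittaker ψ :=
  (basisMonomials Gen ℂ).constr ℂ fun γ => orderedMonomial envVec γ • omega ψ

lemma toWhittaker_monomial (γ : Gen →₀ ℕ) :
    toWhittaker ψ (monomial γ 1) = orderedMonomial envVec γ • omega ψ := by
  have := (basisMonomials Gen ℂ).constr_basis ℂ (fun γ => orderedMonomial envVec γ • omega ψ) γ
  rwa [coe_basisMonomials] at this

lemma toWhittaker_one : toWhittaker ψ 1 = omega ψ := by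
  have := toWhittaker_monomial ψ 0
  rwa [orderedMonomial_zero, one_smul] at this

lemma coord_mem_supported_and_toWhittaker_coord (m : UniversalWhittaker ψ) :
    coord ψ m ∈ supported ℂ positiveᶜ ∧ toWhittaker ψ (coord ψ m) = m := by
  obtain ⟨u, rfl⟩ := exists_smul_omega ψ m
  have hu : u ∈ Submodule.span ℂ (Set.range (orderedMonomial envVec)) := by
    rw [span_orderedMonomial_envVec]
    trivial
  induction hu using Submodule.span_induction with
  | mem u hu =>
    obtain ⟨γ, rfl⟩ := hu
    obtain ⟨α, β, hα, rfl⟩ := exists_negative_add_positive γ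
    rw [coord, liftOmega_smul_omega, orderedMonomial_negative_add_positive hα,
      envCoord_negative_mul ψ hα, map_smul, toWhittaker_monomial, mul_envelopingIncl_smul_omega]
    exact ⟨Subalgebra.smul_mem _ (monomial_mem_supported hα 1) _, rfl⟩
  | zero =>
    rw [zero_smul, map_zero, map_zero]
    exact ⟨Subalgebra.zero_mem _, rfl⟩
  | add u w _ _ hu hw =>
    rw [add_smul, map_add, map_add, hu.2, hw.2]
    exact ⟨Subalgebra.add_mem _ hu.1 hw.1, rfl⟩
  | smul r u _ hu =>
    rw [smul_assoc, (coord ψ).map_smul, (toWhittaker ψ).map_smul, hu.2]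
    exact ⟨Subalgebra.smul_mem _ hu.1 r, rfl⟩

lemma coord_toWhittaker {f : MvPolynomial Gen ℂ} (hf : f ∈ supported ℂ positiveᶜ) :
    coord ψ (toWhittaker ψ f) = f := by
  refine supported_induction (p := fun f => coord ψ (toWhittaker ψ f) = f) ?_ ?_ ?_ hf
  · intro f g hf hg
    rw [map_add, map_add, hf, hg]
  · intro r f hf
    rw [map_smul, map_smul, hf]
  · intro γ hγ
    rw [toWhittaker_monomial, coord, liftOmega_smul_omega, envCoord_orderedMonomial,
      evalPos_monomial_of_negative ψ hγ]

lemma toWhittaker_injOn {f g : MvPolynomial Gen ℂ} (hf : f ∈ supported ℂ positiveᶜ)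
    (hg : g ∈ supported ℂ positiveᶜ) (h : toWhittaker ψ f = toWhittaker ψ g) : f = g := by
  rw [← coord_toWhittaker ψ hf, h, coord_toWhittaker ψ hg]

/-- The letter `x` moves from the left to its place in the ordered monomial past the smaller
letters, which commute with it. -/
lemma vec_lie_toWhittaker {x : Gen} {s : Set Gen}
    (h : ∀ y ∈ s, y < x → ⁅vec x, vec y⁆ = 0) {f : MvPolynomial Gen ℂ} (hf : f ∈ supported ℂ s) :
    ⁅vec x, toWhittaker ψ f⁆ = toWhittaker ψ (X x * f) := by
  refine supported_induction
    (p := fun f => ⁅vec x, toWhittaker ψ f⁆ = toWhittaker ψ (X x * f)) ?_ ?_ ?_ hf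
  · intro f g hf hg
    rw [map_add, lie_add, hf, hg, mul_add, map_add]
  · intro r f hf
    rw [map_smul, lie_smul, hf, mul_smul_comm, map_smul]
  · intro γ hγ
    rw [toWhittaker_monomial, X, monomial_mul, one_mul, toWhittaker_monomial,
      orderedMonomial_single_add, mul_smul]
    · rfl
    · intro y hy hyx
      have := ι_lie (vec x) (vec y)
      rw [h y (hγ y hy) hyx, map_zero] at this
      exact sub_eq_zero.1 this.symm

end Coordinates

/-! ### Action by a scalar plus a derivation. -/

section Derivations

variable (ψ : LieAlgebra.LieCharacter ℂ Twisted.pos)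

/-- The labels of the basis vectors which commute with all those with a negative label. -/
def centralLabels : Set Gen := {x | x = k ∨ ∃ j, x = c j}

lemma centralLabels_subset : centralLabels ⊆ positiveᶜ := by
  rintro _ (rfl | ⟨j, rfl⟩) <;> simp [positive]

lemma vec_lie_vec_eq_zero {x y : Gen} (hx : x ∉ positive) (hy : y ∈ centralLabels) :
    ⁅vec x, vec y⁆ = 0 := by
  obtain rfl | ⟨j, rfl⟩ := hy
  · exact Twisted.lie_k _
  · cases x with
    | d i =>
      change ⁅Twisted.d _, Twisted.c _⁆ = 0
      rw [Twisted.d_lie_c, if_neg (by omega), zero_smul]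
    | v i => exact Twisted.v_lie_c _ _
    | c i => exact Twisted.c_lie_c _ _
    | k => exact Twisted.k_lie _
    | posV i => simp [positive] at hx
    | posC i => simp [positive] at hx
    | posD i => simp [positive] at hx

/-- An element `x` of `Ĥ₄[τ]` acts by a scalar plus a derivation on the ordered monomials in a set
of letters if its commutators with these act by multiplication with central letters. -/
lemma lie_toWhittaker {s : Set Gen} (hs : s ⊆ positiveᶜ) (hcs : centralLabels ⊆ s) {x : Twisted}
    {r : ℂ} (hx : ⁅x, omega ψ⁆ = r • omega ψ) {g : Gen → MvPolynomial Gen ℂ}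
    (hg : ∀ i ∈ s, g i ∈ supported ℂ centralLabels)
    (h : ∀ i ∈ s, ∀ f ∈ supported ℂ s,
      ⁅⁅x, vec i⁆, toWhittaker ψ f⁆ = toWhittaker ψ (g i * f))
    {f : MvPolynomial Gen ℂ} (hf : f ∈ supported ℂ s) :
    ⁅x, toWhittaker ψ f⁆ = toWhittaker ψ (r • f + mkDerivation ℂ g f) := by
  have key (n : ℕ) (γ : Gen →₀ ℕ) (hn : γ.degree = n) (hγ : ∀ i ∈ γ.support, i ∈ s) :
      ⁅x, toWhittaker ψ (monomial γ 1)⁆ =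
        toWhittaker ψ (r • monomial γ 1 + mkDerivation ℂ g (monomial γ 1)) := by
    induction n generalizing γ with
    | zero =>
      obtain rfl : γ = 0 := (Finsupp.degree_eq_zero_iff γ).1 hn
      change ⁅x, toWhittaker ψ 1⁆ = toWhittaker ψ (r • 1 + mkDerivation ℂ g 1)
      rw [Derivation.map_one_eq_zero, add_zero, map_smul, toWhittaker_one, hx]
    | succ n ih =>
      have hne : γ.support.Nonempty := by
        rw [Finsupp.support_nonempty_iff]
        rintro rfl
        simp at hn
      -- The smallest letter is split off because it is the first factor of the ordered monomial.
      set i := γ.support.min' hne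
      have hi : i ∈ γ.support := Finset.min'_mem _ _
      have hle : Finsupp.single i 1 ≤ γ := by
        rw [Finsupp.single_le_iff]
        exact Nat.one_le_iff_ne_zero.2 (Finsupp.mem_support_iff.1 hi)
      obtain ⟨β, hβ⟩ := exists_add_of_le hle
      have hsub : ∀ y ∈ β.support, y ∈ γ.support := fun y hy => by
        rw [Finsupp.mem_support_iff] at hy ⊢
        rw [hβ, Finsupp.add_apply]
        omega
      have hdeg : β.degree = n := by
        rw [hβ, map_add, Finsupp.degree_single] at hn
        omega
      have hβs : ∀ y ∈ β.support, y ∈ s := fun y hy => hγ y (hsub y hy)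
      -- On polynomials in these letters `vec i` acts as multiplication by `X i`. The set includes
      -- the central letters so that the derivation maps these polynomials to themselves.
      set t : Set Gen := {y | y ∈ s ∧ i ≤ y} ∪ centralLabels with ht
      have hβt : (monomial β 1 : MvPolynomial Gen ℂ) ∈ supported ℂ t :=
        monomial_mem_supported (fun y hy =>
          Or.inl ⟨hβs y hy, Finset.min'_le _ _ (hsub y hy)⟩) 1
      have hDt : mkDerivation ℂ g (monomial β 1) ∈ supported ℂ t :=
        mkDerivation_mem_supported (fun y hy => supported_mono Set.subset_union_right
          (hg y (hy.elim (fun h => h.1) (fun h => hcs h)))) hβt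
      have hcomm : ∀ y ∈ t, y < i → ⁅vec i, vec y⁆ = 0 := by
        rintro y (hy | hy) hyi
        · exact absurd hyi (not_lt.2 hy.2)
        · exact vec_lie_vec_eq_zero (hs (hγ i hi)) hy
      have hmon : (monomial γ 1 : MvPolynomial Gen ℂ) = X i * monomial β 1 := by
        rw [X, monomial_mul, one_mul, hβ]
      rw [hmon, ← vec_lie_toWhittaker ψ hcomm hβt, leibniz_lie, ih β hdeg hβs,
        vec_lie_toWhittaker ψ hcomm (Subalgebra.add_mem _ (Subalgebra.smul_mem _ hβt r) hDt),
        h i (hγ i hi) _ (monomial_mem_supported hβs 1), ← map_add, Derivation.leibniz,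
        mkDerivation_X]
      congr 1
      simp only [smul_eq_mul, Algebra.smul_def]
      ring
  refine supported_induction (p := fun f =>
    ⁅x, toWhittaker ψ f⁆ = toWhittaker ψ (r • f + mkDerivation ℂ g f)) ?_ ?_ ?_ hf
  · intro f g hf hg
    rw [map_add, lie_add, hf, hg, ← map_add, map_add (mkDerivation ℂ _), smul_add,
      add_add_add_comm]
  · intro a f hf
    rw [map_smul, lie_smul, hf, ← map_smul, Derivation.map_smul, smul_add, smul_comm]
  · exact fun γ hγ => key _ γ rfl hγ

end Derivations

end NappiWitten

namespace NappiWitten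

open MvPolynomial UniversalWhittaker Gen

/-! ### Locally nilpotent derivations of polynomial rings. -/

section LocallyNilpotent

variable {σ : Type*}

lemma notMem_vars_of_pderiv_eq_zero {f : MvPolynomial σ ℂ} {i : σ} (h : pderiv i f = 0) :
    i ∉ f.vars := by
  intro hi
  obtain ⟨γ, hγ, hiγ⟩ := (mem_vars_iff_mem_support i).1 hi
  have hle : Finsupp.single i 1 ≤ γ := by
    rw [Finsupp.single_le_iff]
    exact Nat.one_le_iff_ne_zero.2 (Finsupp.mem_support_iff.1 hiγ)
  have h' := coeff_pderiv (i := i) f (γ - Finsupp.single i 1)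
  rw [h, coeff_zero, tsub_add_cancel_of_le hle] at h'
  rcases mul_eq_zero.1 h'.symm with h₀ | h₀
  · exact mem_support_iff.1 hγ h₀
  · exact Nat.cast_add_one_ne_zero _ h₀

lemma mkDerivation_single [DecidableEq σ] (i : σ) (g f : MvPolynomial σ ℂ) :
    mkDerivation ℂ (Pi.single i g) f = g * pderiv i f := by
  have : mkDerivation ℂ (Pi.single i g) = g • pderiv (R := ℂ) i := derivation_ext fun j => by
    rw [mkDerivation_X, Derivation.smul_apply, pderiv_X, smul_eq_mul]
    rcases eq_or_ne j i with rfl | h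
    · simp
    · simp [Pi.single_eq_of_ne h]
  rw [this]
  rfl

/-- The second iterate kills every variable. By the Leibniz rule, multiplying by a variable delays
the vanishing by at most one step. -/
lemma exists_iterate_mkDerivation_eq_zero {g : σ → MvPolynomial σ ℂ}
    (hg : ∀ i, mkDerivation ℂ g (g i) = 0) (f : MvPolynomial σ ℂ) :
    ∃ n, (mkDerivation ℂ g)^[n] f = 0 := by
  have hz (n : ℕ) : (mkDerivation ℂ g)^[n] 0 = 0 := Function.iterate_fixed (map_zero _) n
  have hadd (n : ℕ) (p q : MvPolynomial σ ℂ) :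
      (mkDerivation ℂ g)^[n] (p + q) = (mkDerivation ℂ g)^[n] p + (mkDerivation ℂ g)^[n] q := by
    induction n generalizing p q with
    | zero => rfl
    | succ n ih => rw [Function.iterate_succ_apply, map_add, ih]; rfl
  have hmul (i : σ) (n : ℕ) (p : MvPolynomial σ ℂ) :
      (mkDerivation ℂ g)^[n] (p * g i) = (mkDerivation ℂ g)^[n] p * g i := by
    induction n generalizing p with
    | zero => rfl
    | succ n ih =>
      rw [Function.iterate_succ_apply, Derivation.leibniz, hg, smul_zero, zero_add, smul_eq_mul,
        mul_comm, ih]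
      rfl
  have hX (i : σ) (n : ℕ) (p : MvPolynomial σ ℂ) (hp : (mkDerivation ℂ g)^[n] p = 0) :
      (mkDerivation ℂ g)^[n + 1] (p * X i) = 0 := by
    induction n generalizing p with
    | zero =>
      obtain rfl : p = 0 := hp
      rw [zero_mul, hz]
    | succ n ih =>
      rw [Function.iterate_succ_apply, Derivation.leibniz, mkDerivation_X, smul_eq_mul,
        smul_eq_mul, hadd, hmul, hp, zero_mul, zero_add, mul_comm]
      exact ih _ hp
  have hle {m n : ℕ} (h : m ≤ n) {p : MvPolynomial σ ℂ} (hp : (mkDerivation ℂ g)^[m] p = 0) :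
      (mkDerivation ℂ g)^[n] p = 0 := by
    rw [← Nat.sub_add_cancel h, Function.iterate_add_apply, hp, hz]
  induction f using MvPolynomial.induction_on with
  | C a => exact ⟨1, derivation_C _ a⟩
  | add p q hp hq =>
    obtain ⟨m, hm⟩ := hp
    obtain ⟨n, hn⟩ := hq
    exact ⟨max m n, by rw [hadd, hle (le_max_left m n) hm, hle (le_max_right m n) hn, add_zero]⟩
  | mul_X p i hp =>
    obtain ⟨n, hn⟩ := hp
    exact ⟨n + 1, hX i n p hn⟩

lemma eigenvalue_mkDerivation_eq_zero {g : σ → MvPolynomial σ ℂ}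
    (hg : ∀ i, mkDerivation ℂ g (g i) = 0) {f : MvPolynomial σ ℂ} (hf : f ≠ 0) {r : ℂ}
    (h : mkDerivation ℂ g f = r • f) : r = 0 := by
  obtain ⟨n, hn⟩ := exists_iterate_mkDerivation_eq_zero hg f
  have hpow (n : ℕ) : (mkDerivation ℂ g)^[n] f = r ^ n • f := by
    induction n with
    | zero => simp
    | succ n ih => rw [Function.iterate_succ_apply', ih, Derivation.map_smul, h, smul_smul, pow_succ]
  rw [hpow] at hn
  exact eq_zero_of_pow_eq_zero ((smul_eq_zero.1 hn).resolve_right hf)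

end LocallyNilpotent

/-! ### Elimination of the variables other than `k`. -/

section WhittakerVectors

variable (ψ : LieAlgebra.LieCharacter ℂ Twisted.pos)

/-- If an element acts by `r` plus a locally nilpotent derivation, then the derivation vanishes on
its eigenvectors. -/
lemma mkDerivation_eq_zero_of_eigenvector {s : Set Gen} (hs : s ⊆ positiveᶜ)
    (hcs : centralLabels ⊆ s) {x : Twisted} {r r' : ℂ} (hx : ⁅x, omega ψ⁆ = r • omega ψ)
    {g : Gen → MvPolynomial Gen ℂ} (hg : ∀ i ∈ s, g i ∈ supported ℂ centralLabels)
    (h : ∀ i ∈ s, ∀ f ∈ supported ℂ s,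
      ⁅⁅x, vec i⁆, toWhittaker ψ f⁆ = toWhittaker ψ (g i * f))
    (hgg : ∀ i, mkDerivation ℂ g (g i) = 0)
    {f : MvPolynomial Gen ℂ} (hf : f ∈ supported ℂ s) (hne : f ≠ 0)
    (hxf : ⁅x, toWhittaker ψ f⁆ = r' • toWhittaker ψ f) : mkDerivation ℂ g f = 0 := by
  have hD : mkDerivation ℂ g f ∈ supported ℂ s :=
    mkDerivation_mem_supported (fun i hi => supported_mono hcs (hg i hi)) hf
  rw [lie_toWhittaker ψ hs hcs hx hg h hf, ← map_smul] at hxf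
  have heq := toWhittaker_injOn ψ
    (supported_mono hs (Subalgebra.add_mem _ (Subalgebra.smul_mem _ hf r) hD))
    (supported_mono hs (Subalgebra.smul_mem _ hf r')) hxf
  have heq' : mkDerivation ℂ g f = (r' - r) • f := by
    rw [sub_smul, ← heq, add_sub_cancel_left]
  rw [heq', eigenvalue_mkDerivation_eq_zero hgg hne heq', zero_smul]

lemma k_lie_toWhittaker {f : MvPolynomial Gen ℂ} (hf : f ∈ supported ℂ positiveᶜ) :
    ⁅Twisted.k, toWhittaker ψ f⁆ = toWhittaker ψ (X k * f) :=
  vec_lie_toWhittaker ψ (x := k) (fun _ _ _ => Twisted.k_lie _) hf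

lemma c_lie_toWhittaker (j : ℕ) {f : MvPolynomial Gen ℂ} (hf : f ∈ supported ℂ positiveᶜ) :
    ⁅Twisted.c (-j - 1), toWhittaker ψ f⁆ = toWhittaker ψ (X (c j) * f) :=
  vec_lie_toWhittaker ψ (x := c j) (fun y hy _ => by
    rw [← lie_skew, vec_lie_vec_eq_zero hy (Or.inr ⟨j, rfl⟩), neg_zero]) hf

/-- Among the negative letters only `d(-2j-1)` fails to commute with `c(2j+1)`; their bracket is
`(2j+1) k`. -/
lemma posC_lie_vec_lie_toWhittaker (j : ℕ) : ∀ i ∈ positiveᶜ, ∀ f ∈ supported ℂ positiveᶜ,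
    ⁅⁅Twisted.c j, vec i⁆, toWhittaker ψ f⁆ =
      toWhittaker ψ ((Pi.single (d j) ((2 * j + 1 : ℂ) • X k) : Gen → MvPolynomial Gen ℂ) i * f) := by
  intro i hi f hf
  cases i with
  | d i =>
    rw [vec, Twisted.c_lie_d]
    rcases eq_or_ne i j with rfl | hij
    · rw [if_pos (by omega), Pi.single_eq_same, smul_lie, k_lie_toWhittaker ψ hf, smul_mul_assoc,
        map_smul]
      simp
    · rw [if_neg (by omega), Pi.single_eq_of_ne (by simpa using hij)]
      simp
  | v i => rw [vec, Twisted.c_lie_v, Pi.single_eq_of_ne (by simp)]; simp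
  | c i => rw [vec, Twisted.c_lie_c, Pi.single_eq_of_ne (by simp)]; simp
  | k => rw [vec, Twisted.lie_k, Pi.single_eq_of_ne (by simp)]; simp
  | posV i => simp [positive] at hi
  | posC i => simp [positive] at hi
  | posD i => simp [positive] at hi

lemma X_mem_supported_centralLabels {x : Gen} (hx : x ∈ centralLabels) :
    (X x : MvPolynomial Gen ℂ) ∈ supported ℂ centralLabels :=
  X_mem_supported.2 hx

lemma single_mem_supported_centralLabels (x i : Gen) (r : ℂ) :
    (Pi.single x (r • X k) : Gen → MvPolynomial Gen ℂ) i ∈ supported ℂ centralLabels := by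
  rcases eq_or_ne i x with rfl | h
  · rw [Pi.single_eq_same]
    exact Subalgebra.smul_mem _ (X_mem_supported_centralLabels (Or.inl rfl)) _
  · rw [Pi.single_eq_of_ne h]
    exact Subalgebra.zero_mem _

lemma mkDerivation_single_single {x : Gen} (hx : x ≠ k) (i : Gen) (r : ℂ) :
    mkDerivation ℂ (Pi.single x (r • X k) : Gen → MvPolynomial Gen ℂ)
      ((Pi.single x (r • X k) : Gen → MvPolynomial Gen ℂ) i) = 0 := by
  rw [mkDerivation_single]
  rcases eq_or_ne i x with rfl | h
  · rw [Pi.single_eq_same, Derivation.map_smul, pderiv_X_of_ne hx.symm, smul_zero, mul_zero]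
  · rw [Pi.single_eq_of_ne h, map_zero, mul_zero]

/-- The level is not specialized: `k` is a free variable, hence not a zero divisor, and can be
cancelled from `k ∂f/∂x = 0`. -/
lemma notMem_vars_of_mkDerivation_single {x : Gen} (j : ℕ) {f : MvPolynomial Gen ℂ}
    (h : mkDerivation ℂ (Pi.single x ((2 * j + 1 : ℂ) • X k) : Gen → MvPolynomial Gen ℂ) f = 0) : x ∉ f.vars := by
  rw [mkDerivation_single] at h
  refine notMem_vars_of_pderiv_eq_zero ((mul_eq_zero.1 h).resolve_left ?_)
  refine smul_ne_zero ?_ (X_ne_zero _)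
  exact_mod_cast Nat.succ_ne_zero (2 * j)

lemma posC_lie_omega (j : ℕ) : ⁅Twisted.c j, omega ψ⁆ =
    ψ (posVec ⟨posC j, _, Or.inr (Or.inl rfl)⟩) • omega ψ :=
  lie_omega ψ (posVec ⟨posC j, _, Or.inr (Or.inl rfl)⟩)

/-- Because `c(2j+3) = -½ [v(2j+2), v(1)]` is a bracket in the positive part, every character kills
it. This does not reach `c(1)`, since two positive degrees never add up to `1`. -/
lemma character_posC_succ (j : ℕ) : ψ (posVec ⟨posC (j + 1), _, Or.inr (Or.inl rfl)⟩) = 0 := by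
  have h : posVec ⟨posC (j + 1), _, Or.inr (Or.inl rfl)⟩ =
      (-1 / 2 : ℂ) • ⁅posVec ⟨posV (2 * j + 1), _, Or.inl rfl⟩, posVec ⟨posV 0, _, Or.inl rfl⟩⁆ := by
    apply Subtype.ext
    change Twisted.c _ = (-1 / 2 : ℂ) • ⁅Twisted.v _, Twisted.v _⁆
    have he : Even (((2 * j + 1 : ℕ) : ℤ) + 1) := ⟨j + 1, by push_cast; ring⟩
    rw [Twisted.v_lie_v_of_odd _ _ ((j + 1 : ℕ) : ℤ) (by push_cast; ring), smul_smul,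
      he.neg_one_zpow]
    norm_num
  rw [h, map_smul, LieAlgebra.lieCharacter_apply_lie, smul_zero]

/-- The labels of the basis vectors of the negative part of the ideal spanned by the `v n`, `c n`
and `k`. -/
def idealLabels : Set Gen := {x | x ∈ centralLabels ∨ ∃ j, x = v j}

lemma idealLabels_subset : idealLabels ⊆ positiveᶜ := by
  rintro _ (hx | ⟨j, rfl⟩)
  · exact centralLabels_subset hx
  · simp [positive]

/-- The derivation part of `c(2j+1)` differentiates by a letter `d`, and none occurs here. -/
lemma posC_lie_toWhittaker (j : ℕ) {f : MvPolynomial Gen ℂ} (hf : f ∈ supported ℂ idealLabels) :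
    ⁅Twisted.c j, toWhittaker ψ f⁆ =
      toWhittaker ψ (C (ψ (posVec ⟨posC j, _, Or.inr (Or.inl rfl)⟩)) * f) := by
  rw [lie_toWhittaker ψ subset_rfl centralLabels_subset (posC_lie_omega ψ j)
    (fun i _ => single_mem_supported_centralLabels _ i _) (posC_lie_vec_lie_toWhittaker ψ j)
    (supported_mono idealLabels_subset hf), mkDerivation_single, pderiv_eq_zero_of_notMem_vars,
    mul_zero, add_zero, C_mul']
  intro h
  rcases mem_supported.1 hf h with (h | ⟨i, h⟩) | ⟨i, h⟩ <;> cases h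

/-- The bracket has degree `m + 1 - i`. For `i < m` it is zero or a multiple of some `c(n)` with `n
≥ 3`, which acts by zero. For `i = m` it is a nonzero multiple of `c(1)`, which acts by `ψ(c(1))`.
For `i > m` it is zero or a multiple of `k` or of a negative `c`. -/
lemma exists_posV_lie_v (hψ : ψ Twisted.posC1 ≠ 0) (m i : ℕ) : ∃ g ∈ supported ℂ centralLabels,
    (∀ f ∈ supported ℂ idealLabels,
      ⁅⁅Twisted.v (m + 1), Twisted.v (-i)⁆, toWhittaker ψ f⁆ = toWhittaker ψ (g * f)) ∧
    (i < m → g = 0) ∧ (i = m → ∃ r : ℂ, r ≠ 0 ∧ g = C r) := by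
  rcases Int.even_or_odd ((m + 1 : ℤ) + -i) with h | ⟨l, h⟩
  · have hne : i ≠ m := by
      rintro rfl
      obtain ⟨l, hl⟩ := h
      omega
    rw [Twisted.v_lie_v_of_even _ _ h]
    split_ifs with h₀
    · generalize (2 * (-1 : ℂ) ^ (m + 1 : ℤ) * ((m + 1 : ℤ) : ℂ)) = r
      refine ⟨r • X k,
        Subalgebra.smul_mem _ (X_mem_supported_centralLabels (Or.inl rfl)) _,
        fun f hf => ?_, fun _ => by omega, fun h => absurd h hne⟩
      rw [smul_lie, k_lie_toWhittaker ψ (supported_mono idealLabels_subset hf), smul_mul_assoc,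
        map_smul]
    · refine ⟨0, Subalgebra.zero_mem _, fun f _ => ?_, fun _ => rfl, fun h => absurd h hne⟩
      rw [zero_smul, zero_lie, zero_mul, map_zero]
  · rw [Twisted.v_lie_v_of_odd _ _ l h]
    have hr : (-2 * (-1 : ℂ) ^ (m + 1 : ℤ)) ≠ 0 :=
      mul_ne_zero (by norm_num) (zpow_ne_zero _ (by norm_num))
    generalize (-2 * (-1 : ℂ) ^ (m + 1 : ℤ)) = r at hr ⊢
    rcases lt_or_ge l 0 with hl | hl
    · obtain ⟨j, rfl⟩ : ∃ j : ℕ, l = -j - 1 := ⟨(-l - 1).toNat, by omega⟩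
      refine ⟨r • X (c j), Subalgebra.smul_mem _ (X_mem_supported_centralLabels (Or.inr ⟨j, rfl⟩)) _,
        fun f hf => ?_, fun _ => by omega, fun _ => by omega⟩
      rw [smul_lie, c_lie_toWhittaker ψ j (supported_mono idealLabels_subset hf), smul_mul_assoc,
        map_smul]
    · lift l to ℕ using hl
      refine ⟨r • C (ψ (posVec ⟨posC l, _, Or.inr (Or.inl rfl)⟩)),
        Subalgebra.smul_mem _ (Subalgebra.algebraMap_mem _ _) _, fun f hf => ?_,
        fun hi => ?_, fun hi => ?_⟩
      · rw [smul_lie, posC_lie_toWhittaker ψ l hf, smul_mul_assoc, map_smul]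
      · obtain ⟨l, rfl⟩ : ∃ l', l = l' + 1 := ⟨l - 1, by omega⟩
        rw [character_posC_succ, C_0, smul_zero]
      · obtain rfl : l = 0 := by omega
        refine ⟨r * ψ Twisted.posC1, mul_ne_zero hr hψ, ?_⟩
        rw [smul_eq_C_mul, C_mul]
        rfl

/-- The coordinates of a Whittaker vector involve only `k`. -/
theorem mem_supported_k_of_isWhittakerVector (hψ : ψ Twisted.posC1 ≠ 0)
    {ψ' : LieAlgebra.LieCharacter ℂ Twisted.pos} {f : MvPolynomial Gen ℂ}
    (hf : f ∈ supported ℂ positiveᶜ) (h : IsWhittakerVector ψ' (toWhittaker ψ f)) :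
    f ∈ supported ℂ {k} := by
  have hne : f ≠ 0 := by
    rintro rfl
    exact h.1 (map_zero _)
  -- No `d` occurs: the operators `c(2j+1)` differentiate by `d(-2j-1)`.
  have hd (j : ℕ) : d j ∉ f.vars := notMem_vars_of_mkDerivation_single j
    (mkDerivation_eq_zero_of_eigenvector ψ subset_rfl centralLabels_subset (posC_lie_omega ψ j)
      (fun i _ => single_mem_supported_centralLabels _ i _) (posC_lie_vec_lie_toWhittaker ψ j)
      (fun i => mkDerivation_single_single (by simp) i _) hf hne
      (h.2 (posVec ⟨posC j, _, Or.inr (Or.inl rfl)⟩)))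
  have hf₁ : f ∈ supported ℂ idealLabels := mem_supported.2 fun x hx => by
    have hx' := mem_supported.1 hf hx
    cases x with
    | d i => exact absurd hx (hd i)
    | v i => exact Or.inr ⟨i, rfl⟩
    | c i => exact Or.inl (Or.inr ⟨i, rfl⟩)
    | k => exact Or.inl (Or.inl rfl)
    | posV i => simp [positive] at hx'
    | posC i => simp [positive] at hx'
    | posD i => simp [positive] at hx'
  have hv (j : ℕ) : v j ∉ f.vars := by
    intro hj
    have hfin : {i : ℕ | v i ∈ f.vars}.Finite :=
      f.vars.finite_toSet.preimage (f := v) fun i _ i' _ hi => by cases hi; rfl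
    -- The largest index `m` determines the operator `v(m+1)` that is applied.
    obtain ⟨m, hm, hmax⟩ := Set.exists_max_image _ (fun i => i) hfin ⟨j, hj⟩
    choose g hgs hg hg₀ hg₁ using exists_posV_lie_v ψ hψ m
    obtain ⟨r, hr, hgr⟩ := hg₁ m rfl
    set G : Gen → MvPolynomial Gen ℂ := fun x =>
      match x with
      | v i => g i
      | _ => 0 with hG
    have hGc : ∀ x ∈ centralLabels, G x = 0 := by
      rintro x (rfl | ⟨i, rfl⟩) <;> rfl
    have hGs : ∀ x, G x ∈ supported ℂ centralLabels := by
      intro x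
      cases x with
      | v i => exact hgs i
      | _ => exact Subalgebra.zero_mem _
    have hD : mkDerivation ℂ G f = 0 := by
      refine mkDerivation_eq_zero_of_eigenvector ψ idealLabels_subset (fun x hx => Or.inl hx)
        (lie_omega ψ (posVec ⟨posV m, _, Or.inl rfl⟩)) (fun x _ => hGs x) ?_ ?_ hf₁ hne
        (h.2 (posVec ⟨posV m, _, Or.inl rfl⟩))
      · rintro x (hx | ⟨i, rfl⟩) f' hf'
        · obtain rfl | ⟨i, rfl⟩ := hx
          · rw [hGc _ (Or.inl rfl), vec, Twisted.lie_k, zero_lie, zero_mul, map_zero]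
          · rw [hGc _ (Or.inr ⟨i, rfl⟩), zero_mul, map_zero]
            change ⁅⁅Twisted.v _, Twisted.c _⁆, _⁆ = _
            rw [Twisted.v_lie_c, zero_lie]
        · exact hg i f' hf'
      -- The values of `G` involve only central letters, and the derivation vanishes on these.
      · intro x
        refine derivation_eq_zero_of_forall_mem_vars fun y hy => ?_
        rw [mkDerivation_X]
        exact hGc y (mem_supported.1 (hGs x) hy)
    -- On the variables of `f` the two derivations agree: `G` vanishes at `v i` for `i < m`, equals
    -- the constant `r` at `v m`, and no `v i` with `i > m` occurs.
    have hD' : mkDerivation ℂ G f = ((C r : MvPolynomial Gen ℂ) • pderiv (R := ℂ) (v m)) f := by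
      refine derivation_eq_of_forall_mem_vars fun x hx => ?_
      rw [mkDerivation_X, Derivation.smul_apply]
      rcases mem_supported.1 hf₁ hx with hx' | ⟨i, rfl⟩
      · rw [hGc x hx', pderiv_X_of_ne, smul_zero]
        rintro rfl
        rcases hx' with hx' | ⟨i, hx'⟩ <;> cases hx'
      · rcases lt_trichotomy i m with hi | rfl | hi
        · rw [pderiv_X_of_ne (by intro he; cases he; omega), smul_zero]
          exact hg₀ i hi
        · rw [pderiv_X_self, smul_eq_mul, mul_one]
          exact hgr
        · exact absurd (hmax i hx) (not_le.2 hi)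
    rw [hD, Derivation.smul_apply, smul_eq_mul, eq_comm, mul_eq_zero, C_eq_zero] at hD'
    exact notMem_vars_of_pderiv_eq_zero (hD'.resolve_left hr) hm
  have hf₂ : f ∈ supported ℂ centralLabels := mem_supported.2 fun x hx => by
    rcases mem_supported.1 hf₁ hx with hx' | ⟨i, rfl⟩
    · exact hx'
    · exact absurd hx (hv i)
  -- Only now can `d(2j+1)` be used: on polynomials in the `c` and `k` its derivation is `(2j+1) k
  -- ∂/∂c(-2j-1)`, whereas its bracket with a `v` would not be central.
  have hc (j : ℕ) : c j ∉ f.vars := notMem_vars_of_mkDerivation_single j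
    (mkDerivation_eq_zero_of_eigenvector ψ centralLabels_subset subset_rfl
      (lie_omega ψ (posVec ⟨posD j, _, Or.inr (Or.inr rfl)⟩))
      (fun i _ => single_mem_supported_centralLabels _ i _)
      (by
        rintro i (rfl | ⟨i, rfl⟩) f' hf'
        · rw [Pi.single_eq_of_ne (by simp), zero_mul, map_zero, vec, Twisted.lie_k, zero_lie]
        · change ⁅⁅Twisted.d j, Twisted.c (-i - 1)⁆, _⁆ = _
          rw [Twisted.d_lie_c]
          rcases eq_or_ne i j with rfl | hij
          · rw [if_pos (by omega), Pi.single_eq_same, smul_lie,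
              k_lie_toWhittaker ψ (supported_mono centralLabels_subset hf'), smul_mul_assoc,
              map_smul]
            simp
          · rw [if_neg (by omega), Pi.single_eq_of_ne (by simpa using hij)]
            simp)
      (fun i => mkDerivation_single_single (by simp) i _) hf₂ hne
      (h.2 (posVec ⟨posD j, _, Or.inr (Or.inr rfl)⟩)))
  refine mem_supported.2 fun x hx => ?_
  rcases mem_supported.1 hf₂ hx with hx' | ⟨i, rfl⟩
  · exact hx'
  · exact absurd hx (hc i)

lemma exists_polyK_smul_omega {f : MvPolynomial Gen ℂ} (hf : f ∈ supported ℂ {k}) :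
    ∃ u ∈ polyK, toWhittaker ψ f = u • omega ψ := by
  refine supported_induction (p := fun f => ∃ u ∈ polyK, toWhittaker ψ f = u • omega ψ)
    ?_ ?_ ?_ hf
  · rintro f g ⟨u, hu, hf⟩ ⟨w, hw, hg⟩
    exact ⟨u + w, Subalgebra.add_mem _ hu hw, by rw [map_add, hf, hg, add_smul]⟩
  · rintro r f ⟨u, hu, hf⟩
    exact ⟨r • u, Subalgebra.smul_mem _ hu r, by rw [map_smul, hf, smul_assoc]⟩
  · intro γ hγ
    refine ⟨_, ?_, toWhittaker_monomial ψ γ⟩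
    refine Subalgebra.list_prod_mem _ fun u hu => ?_
    obtain ⟨x, hx, rfl⟩ := List.mem_map.1 hu
    rw [Multiset.mem_sort, Finsupp.mem_toMultiset] at hx
    obtain rfl : x = k := hγ x hx
    exact Algebra.subset_adjoin rfl

lemma commute_ι_of_mem_polyK {u : UniversalEnvelopingAlgebra ℂ Twisted} (hu : u ∈ polyK)
    (x : Twisted) : Commute (UniversalEnvelopingAlgebra.ι ℂ x) u := by
  induction hu using Algebra.adjoin_induction with
  | mem u hu =>
    obtain rfl := hu
    have := ι_lie x Twisted.k
    rw [Twisted.lie_k, map_zero] at this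
    exact sub_eq_zero.1 this.symm
  | algebraMap r => exact (Algebra.commutes r _).symm
  | add u w _ _ hu hw => exact hu.add_right hw
  | mul u w _ _ hu hw => exact hu.mul_right hw

lemma isWhittakerVector_of_polyK {v : UniversalWhittaker ψ} (hv : v ≠ 0)
    {u : UniversalEnvelopingAlgebra ℂ Twisted} (hu : u ∈ polyK) (h : v = u • omega ψ) :
    IsWhittakerVector ψ v := by
  refine ⟨hv, fun x => ?_⟩
  subst h
  have hω := lie_omega ψ x
  rw [bracket_eq] at hω ⊢
  rw [smul_smul, (commute_ι_of_mem_polyK hu x).eq, mul_smul, hω, smul_algebra_smul_comm]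

lemma exists_polyK_of_isWhittakerVector (hψ : ψ Twisted.posC1 ≠ 0)
    {ψ' : LieAlgebra.LieCharacter ℂ Twisted.pos} {v : UniversalWhittaker ψ}
    (h : IsWhittakerVector ψ' v) : v ≠ 0 ∧ ∃ u ∈ polyK, v = u • omega ψ := by
  obtain ⟨hs, hv⟩ := coord_mem_supported_and_toWhittaker_coord ψ v
  refine ⟨h.1, ?_⟩
  have := exists_polyK_smul_omega ψ (mem_supported_k_of_isWhittakerVector ψ hψ hs (hv.symm ▸ h))
  rwa [hv] at this

end WhittakerVectors

end NappiWitten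

end

theorem corollary3p8
    (ψ : LieAlgebra.LieCharacter ℂ NappiWitten.Twisted.pos)
    (hψ : ψ NappiWitten.Twisted.posC1 ≠ 0)
    (v : NappiWitten.UniversalWhittaker ψ) :
    (NappiWitten.IsWhittakerVector ψ v ↔
      v ≠ 0 ∧ ∃ u ∈ NappiWitten.polyK, v = u • NappiWitten.UniversalWhittaker.omega ψ) ∧
    ((∃ ψ' : LieAlgebra.LieCharacter ℂ NappiWitten.Twisted.pos,
        NappiWitten.IsWhittakerVector ψ' v) ↔
      v ≠ 0 ∧ ∃ u ∈ NappiWitten.polyK, v = u • NappiWitten.UniversalWhittaker.omega ψ) := by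
  refine ⟨⟨NappiWitten.exists_polyK_of_isWhittakerVector ψ hψ, ?_⟩, ⟨?_, ?_⟩⟩
  · rintro ⟨hv, u, hu, h⟩
    exact NappiWitten.isWhittakerVector_of_polyK ψ hv hu h
  · rintro ⟨ψ', h⟩
    exact NappiWitten.exists_polyK_of_isWhittakerVector ψ hψ h
  · rintro ⟨hv, u, hu, h⟩
    exact ⟨ψ, NappiWitten.isWhittakerVector_of_polyK ψ hv hu h⟩
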